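/- **Setting.** Let $T\ge 2$ and $K\ge 1$ be integers and let $l_1,\dots,l_T\in[0,1]^K$ be an arbitrary fixed sequence of loss vectors. For $1\le S\le T-1$ let $B_S$ be the set of $\sigma\in[K]^T$ with $\sum_{t=1}^{T-1}\mathbf 1\{\sigma_t\ne\sigma_{t+1}\}\le S$. The $S$-switch regret of an algorithm playing random arms $a_1,\dots,a_T$ is $$R_S(T)=\max_{\sigma\in B_S}\sum_{t=1}^T\bigl(\mathbb E[l_t(a_t)]-l_t(\sigma_t)\bigr).$$ Let $\mathcal H=\{T^{i/\lceil\log T\rceil}: i=0,\dots,\lceil\log T\rceil\}$ and $H=|\mathcal H|$, and let $h^\dagger$ be the largest $h\in\mathcal H$ with $h\le S$. For $F$ differentiable at $q$ let $D_F(p,q)=F(p)-F(q)-\langle\nabla F(q),p-q\rangle$. Let $\mathcal A_{\mathcal H}$ be the set of probability vectors on $\mathcal H$ with all entries at least $\alpha=1/(TH)$, and $\mathcal A_{\mathcal K}$ the set of probability vectors on $[K]$ with all entries at least $\beta=1/(TK)$. **Algorithm** (with parameter $\eta>0$; it does not know $S$). Put $\gamma=e^{1/\log T}$, $p_1(h)=1/H$,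 $p_{1,h}(a)=1/K$, $\rho_1(h)=2H$, $\xi_1(h)=\eta$. In each round $t=1,\dots,T$: 1. Draw $h_t\sim p_t$, then $a_t\sim p_{t,h_t}$, and observe $l_t(a_t)$. Put $l'_t(h)=\frac{l_t(a_t)}{p_t(h)}\mathbf 1\{h=h_t\}$ and $l''_{t,h}(a)=\frac{l'_t(h)}{p_{t,h}(a)}\mathbf 1\{a=a_t\}$. 2. With $F_{\xi_t}(p)=-\sum_{h}\frac{\log p(h)}{\xi_t(h)}$, put $p_{t+1}=\arg\min_{p\in\mathcal A_{\mathcal H}}\langle p,l'_t\rangle+D_{F_{\xi_t}}(p,p_t)$. 3. With $\eta_t(h)=\sqrt{h/(KT\rho_t(h))}$ and $F_{\eta_t(h)}(p)=\frac1{\eta_t(h)}\sum_{a}(p(a)\log p(a)-p(a))$, put $p_{t+1,h}=\arg\min_{p\in\mathcal A_{\mathcal K}}\langle p,l''_{t,h}\rangle+D_{F_{\eta_t(h)}}(p,p_{t,h})$ for each $h\in\mathcal H$. 4. For each $h\in\mathcal H$: if $1/p_{t+1}(h)>\rho_t(h)$, put $\rho_{t+1}(h)=2/p_{t+1}(h)$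 and $\xi_{t+1}(h)=\gamma\,\xi_t(h)$; otherwise put $\rho_{t+1}(h)=\rho_t(h)$ and $\xi_{t+1}(h)=\xi_t(h)$. **Theorem.** There are universal constants $C>0$ and $m\in\mathbb N$ such that for all integers $K\ge1$ and $T\ge2$, all $S\in\{1,\dots,T-1\}$ and all loss sequences in $[0,1]^K$, the algorithm with $\eta=\sqrt{H/(KT)}$ satisfies $$R_S(T)\le C(\log T)^m\,\min\Bigl\{\mathbb E\bigl[\sqrt{SKT\rho_T(h^\dagger)}\bigr],\;S\sqrt{KT}\Bigr\}.$$ With $\eta=\sqrt{H/T}$ instead, the first of the two bounds holds: $R_S(T)\le C(\log T)^m\,\mathbb E\bigl[\sqrt{SKT\rho_T(h^\dagger)}\bigr]$. -/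

import Mathlib

noncomputable section

namespace SwitchOMD

/-! ### Online mirror descent -/

/-- The Bregman divergence `D_F(p, q) = F(p) - F(q) - ⟨∇F(q), p - q⟩`. -/
def bregman {ι : Type*} [Fintype ι] (F : (ι → ℝ) → ℝ) (p q : ι → ℝ) : ℝ :=
  F p - F q - fderiv ℝ F q (p - q)

/-- The negative entropy regularizer with learning rate `η`. -/
def negEntropy {ι : Type*} [Fintype ι] (η : ℝ) (p : ι → ℝ) : ℝ :=
  (1 / η) * ∑ i, (p i * Real.log (p i) - p i)

/-- The log-barrier regularizer with one learning rate `ξ i` for each coordinate. -/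
def logBarrier {ι : Type*} [Fintype ι] (ξ : ι → ℝ) (p : ι → ℝ) : ℝ :=
  -∑ i, Real.log (p i) / ξ i

/-- The clipped probability simplex: probability vectors with all entries in `[c, 1]`. -/
def clippedSimplex (ι : Type*) [Fintype ι] (c : ℝ) : Set (ι → ℝ) :=
  {p | ∑ i, p i = 1 ∧ ∀ i, p i ∈ Set.Icc c 1}

/-- A minimizer of `f` over `s` (an arbitrary point if there is none). -/
def argminOn {E : Type*} [Nonempty E] (s : Set E) (f : E → ℝ) : E :=
  Classical.epsilon fun x => x ∈ s ∧ IsMinOn f s x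

/-- One step of online mirror descent over `s` with regularizer `F`, from the point `p`, with the
(estimated) loss vector `g`: `argmin_{q ∈ s} ⟨q, g⟩ + D_F(q, p)`. -/
def omdStep {ι : Type*} [Fintype ι] (s : Set (ι → ℝ)) (F : (ι → ℝ) → ℝ) (p g : ι → ℝ) : ι → ℝ :=
  argminOn s fun q => ∑ i, q i * g i + bregman F q p

/-! ### The candidate switch numbers (one base algorithm for each) -/

/-- The number `H = ⌈log T⌉ + 1` of candidates. -/
def numBases (T : ℕ) : ℕ := ⌈Real.log T⌉₊ + 1

instance (T : ℕ) : NeZero (numBases T) := ⟨Nat.succ_ne_zero _⟩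

/-- The bases are indexed by `i = 0, …, ⌈log T⌉`. -/
abbrev Base (T : ℕ) : Type := Fin (numBases T)

/-- The `i`-th candidate `h = T ^ (i / ⌈log T⌉)`. -/
def cand (T : ℕ) (i : Base T) : ℝ := (T : ℝ) ^ (((i : ℕ) : ℝ) / ((⌈Real.log T⌉₊ : ℕ) : ℝ))

/-- The base `h†` whose candidate is the largest one that is at most `S`
(candidates increase with their index). -/
def nearOpt (T S : ℕ) : Base T :=
  (Finset.univ.filter fun i : Base T => cand T i ≤ (S : ℝ)).sup id

/-! ### The adaptive master-base algorithm -/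

/-- What the algorithm holds at the beginning of a round `t`. -/
structure State (T K : ℕ) where
  /-- the distribution `p_t` of the master over the bases -/
  p : Base T → ℝ
  /-- the distributions `p_{t,h}` of the bases over the arms -/
  q : Base T → Fin K → ℝ
  /-- the variance thresholds `ρ_t(h)` -/
  rho : Base T → ℝ
  /-- the learning rates `ξ_t(h)` of the master -/
  xi : Base T → ℝ

/-- The state at the beginning of the first round, with initial master learning rate `η`. -/
def initState (T K : ℕ) (η : ℝ) : State T K where
  p := fun _ => 1 / (numBases T : ℝ)
  q := fun _ _ => 1 / (K : ℝ)
  rho := fun _ => 2 * (numBases T : ℝ)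
  xi := fun _ => η

/-- The learning rate `η_t(h) = √(h / (K T ρ_t(h)))` of base `h`. -/
def baseRate {T K : ℕ} (s : State T K) (h : Base T) : ℝ :=
  √(cand T h / ((K : ℝ) * (T : ℝ) * s.rho h))

/-- The estimator `l'_t(h)` when base `h₀` was drawn and the observed loss is `x`. -/
def baseLossEst {T K : ℕ} (s : State T K) (h₀ : Base T) (x : ℝ) (h : Base T) : ℝ :=
  if h = h₀ then x / s.p h else 0

/-- The estimator `l''_{t,h}(a)` when base `h₀` and arm `a₀` were drawn and the observed loss
is `x`. -/
def armLossEst {T K : ℕ} (s : State T K) (h₀ : Base T) (a₀ : Fin K) (x : ℝ)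
    (h : Base T) (a : Fin K) : ℝ :=
  if a = a₀ then baseLossEst s h₀ x h / s.q h a else 0

/-- The master distribution `p_{t+1}`, with clipping level `1 / (T H)`. -/
def nextP {T K : ℕ} (s : State T K) (h₀ : Base T) (x : ℝ) : Base T → ℝ :=
  omdStep (clippedSimplex (Base T) (1 / ((T : ℝ) * (numBases T : ℝ))))
    (logBarrier s.xi) s.p (baseLossEst s h₀ x)

/-- The base distribution `p_{t+1,h}`, with clipping level `1 / (T K)`. -/
def nextQ {T K : ℕ} (s : State T K) (h₀ : Base T) (a₀ : Fin K) (x : ℝ) (h : Base T) :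
    Fin K → ℝ :=
  omdStep (clippedSimplex (Fin K) (1 / ((T : ℝ) * (K : ℝ))))
    (negEntropy (baseRate s h)) (s.q h) (armLossEst s h₀ a₀ x h)

/-- One round: base `h₀` and arm `a₀` were drawn and the loss `x` of that arm was observed. -/
def step {T K : ℕ} (s : State T K) (h₀ : Base T) (a₀ : Fin K) (x : ℝ) : State T K where
  p := nextP s h₀ x
  q := nextQ s h₀ a₀ x
  rho := fun h => if s.rho h < 1 / nextP s h₀ x h then 2 / nextP s h₀ x h else s.rho h
  xi := fun h =>
    if s.rho h < 1 / nextP s h₀ x h then Real.exp (1 / Real.log T) * s.xi h else s.xi h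

/-! ### The random run against a fixed loss sequence -/

/-- The outcome of all draws: the pair `(h_t, a_t)` for every round. Rounds are numbered from `0`
here, so the round `t : Fin T` is the `(t + 1)`-st one. -/
abbrev History (T K : ℕ) : Type := Fin T → Base T × Fin K

/-- The state after `t` rounds, that is, at the beginning of the `(t + 1)`-st round, if the draws
are `ω`. -/
def stateAt {T K : ℕ} (η : ℝ) (l : Fin T → Fin K → ℝ) (ω : History T K) : ℕ → State T K
  | 0 => initState T K η
  | t + 1 =>
    if ht : t < T then
      step (stateAt η l ω t) (ω ⟨t, ht⟩).1 (ω ⟨t, ht⟩).2 (l ⟨t, ht⟩ (ω ⟨t, ht⟩).2)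
    else stateAt η l ω t

/-- The probability of the draws `ω`: in each round the base is drawn from `p_t`, then the arm
from the distribution of that base. -/
def prob {T K : ℕ} (η : ℝ) (l : Fin T → Fin K → ℝ) (ω : History T K) : ℝ :=
  ∏ t : Fin T, ((stateAt η l ω t).p (ω t).1 * (stateAt η l ω t).q (ω t).1 (ω t).2)

/-- The expectation of `X` over the draws of the algorithm. -/
def expect {T K : ℕ} (η : ℝ) (l : Fin T → Fin K → ℝ) (X : History T K → ℝ) : ℝ :=
  ∑ ω, prob η l ω * X ω

/-- The variance threshold `ρ_T(h)`, in force at the beginning of the last round. -/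
def rhoT {T K : ℕ} (η : ℝ) (l : Fin T → Fin K → ℝ) (h : Base T) (ω : History T K) : ℝ :=
  (stateAt η l ω (T - 1)).rho h

/-! ### The switching regret -/

/-- The action sequences with at most `S` switches. -/
def switchSeqs (T K S : ℕ) : Set (Fin T → Fin K) :=
  {σ | ∑ t : Fin (T - 1),
      (if σ ⟨t, by omega⟩ ≠ σ ⟨t + 1, by omega⟩ then 1 else 0) ≤ S}

/-- The `S`-switch regret
`R_S(T) = max_{σ ∈ B_S} ∑_t (E[l_t(a_t)] - l_t(σ_t))` of the algorithm with initial master learning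
rate `η` on the losses `l`. -/
def switchRegret {T K : ℕ} (S : ℕ) (η : ℝ) (l : Fin T → Fin K → ℝ) : ℝ :=
  sSup ((fun σ : Fin T → Fin K =>
    ∑ t : Fin T, (expect η l (fun ω => l t (ω t).2) - l t (σ t))) '' switchSeqs T K S)

end SwitchOMD

end

/-!
The algorithm runs one mirror-descent base per candidate switch number and a mirror-descent master
over the bases. Fix `h = h†`, for which `h ≤ S ≤ 3h` (`cand_nearOpt`). Since all estimators are
unbiased, the expected regret splits, up to the cost `2` of moving the comparators into the clipped
simplices, into the regret of the master against `h` and the regret of base `h` against `σ`, both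
on the estimated losses (`round_regret`). Both are bounded for every outcome of the draws, from the
three-point inequality of mirror descent (`omdStep_spec`) and a stability estimate that needs no
bound on the losses because they are nonnegative (`isDiv_stability`, `klDiv_stability`).

* **Base.** With the learning rates `η_t(h)` nonincreasing and all relative entropies at most
  `log (TK)`, the divergences telescope except at the switches, which gives
  `(S + 1) log (TK) / η_T(h)` (`base_regret`). The second-order term is at most
  `η_t(h) K / p_t(h) ≤ η_t(h) K ρ_t(h)` in conditional expectation. Together these are of order
  `log (TK) √(S K T ρ_T(h))` (`baseRate_mul_le`, `inv_baseRate_nearOpt_le`).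
* **Master.** The threshold `ρ_t(h)` at least doubles whenever `ξ_t(h)` is multiplied by
  `e ^ (1 / log T)`, and it is at most `2TH`, so that all rates stay below `8η`
  (`State.Invariant.xi_le_eight_mul`). The local norms of the log-barrier are at most `1`, so the
  second-order terms sum to `8ηT`. When `ρ(h)` grows, the divergence of the comparator is of the
  order of the new `ρ(h)`, and the growth of `ξ(h)` turns a fraction of order `1 / log T` of it into
  a gain. Hence the regret is at most `H (log T + 2) / η + 8ηT - ρ_T(h) / (64 η (1 + log T))`
  (`master_regret`).

Dropping the negative term gives the bound by `E √(S K T ρ_T(h))`, because `ρ_T ≥ 2H`. With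
`η = √(H / (KT))`, the negative term dominates `√(S K T ρ_T(h))` up to `S √(KT)` times a power of
`log T`, by the arithmetic-geometric mean inequality. If `K ≥ T`, then `log K` is not controlled by
`log T`, but then the trivial bound `T` on the regret suffices.
-/

noncomputable section

namespace SwitchOMD

/-! ### One step of online mirror descent -/

section Separable

variable {ι : Type*} [Fintype ι]

lemma isCompact_clippedSimplex (c : ℝ) : IsCompact (clippedSimplex ι c) := by
  have hK : IsCompact (Set.pi Set.univ fun _ : ι => Set.Icc c (1 : ℝ)) :=
    isCompact_univ_pi fun _ => isCompact_Icc
  refine hK.of_isClosed_subset ?_ fun p hp i _ => hp.2 i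
  have h1 : IsClosed {p : ι → ℝ | ∑ i, p i = 1} :=
    isClosed_eq (by fun_prop) continuous_const
  have h2 : IsClosed {p : ι → ℝ | ∀ i, p i ∈ Set.Icc c 1} := by
    rw [Set.ofPred_forall]
    exact isClosed_iInter fun i => isClosed_Icc.preimage (continuous_apply i)
  exact h1.inter h2

lemma convex_clippedSimplex (c : ℝ) : Convex ℝ (clippedSimplex ι c) := by
  intro p hp q hq a b ha hb hab
  refine ⟨?_, fun i => (convex_Icc c 1) (hp.2 i) (hq.2 i) ha hb hab⟩
  simp only [Pi.add_apply, Pi.smul_apply, smul_eq_mul, Finset.sum_add_distrib,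
    ← Finset.mul_sum, hp.1, hq.1, mul_one, hab]

lemma hasFDerivAt_separable {f f' : ι → ℝ → ℝ} {q : ι → ℝ}
    (hf : ∀ i, HasDerivAt (f i) (f' i (q i)) (q i)) :
    HasFDerivAt (fun p : ι → ℝ => ∑ i, f i (p i))
      (∑ i, f' i (q i) • ContinuousLinearMap.proj (R := ℝ) (φ := fun _ : ι => ℝ) i) q := by
  refine HasFDerivAt.fun_sum fun i _ => ?_
  exact (hf i).comp_hasFDerivAt q (ContinuousLinearMap.proj (R := ℝ) (φ := fun _ : ι => ℝ) i).hasFDerivAt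

lemma bregman_separable {f f' : ι → ℝ → ℝ} {q : ι → ℝ}
    (hf : ∀ i, HasDerivAt (f i) (f' i (q i)) (q i)) (p : ι → ℝ) :
    bregman (fun p : ι → ℝ => ∑ i, f i (p i)) p q =
      ∑ i, (f i (p i) - f i (q i) - f' i (q i) * (p i - q i)) := by
  rw [bregman, (hasFDerivAt_separable hf).fderiv]
  simp [Finset.sum_sub_distrib]

/-- The mirror descent step over the clipped simplex is a point of the simplex and satisfies the
three-point inequality, which is its first-order optimality condition. -/
lemma omdStep_spec {f f' : ι → ℝ → ℝ} {c : ℝ} (hc : 0 < c)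
    (hf : ∀ i x, 0 < x → HasDerivAt (f i) (f' i x) x) {p : ι → ℝ}
    (hp : p ∈ clippedSimplex ι c) (g : ι → ℝ) :
    let F : (ι → ℝ) → ℝ := fun p => ∑ i, f i (p i)
    let p' := omdStep (clippedSimplex ι c) F p g
    p' ∈ clippedSimplex ι c ∧ ∀ u ∈ clippedSimplex ι c,
      ∑ i, (p' i - u i) * g i ≤ bregman F u p - bregman F u p' - bregman F p' p := by
  intro F p'
  have hpos : ∀ q ∈ clippedSimplex ι c, ∀ i, 0 < q i := fun q hq i => hc.trans_le (hq.2 i).1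
  have hF : ∀ q ∈ clippedSimplex ι c, ∀ i, HasDerivAt (f i) (f' i (q i)) (q i) :=
    fun q hq i => hf i _ (hpos q hq i)
  set A : (ι → ℝ) → ℝ := fun q => ∑ i, q i * g i + bregman F q p with hA
  -- the objective is itself separable
  set a : ι → ℝ → ℝ := fun i x => x * g i + (f i x - f i (p i) - f' i (p i) * (x - p i)) with ha
  have hAa : A = fun q => ∑ i, a i (q i) := by
    funext q
    simp only [hA, ha, Finset.sum_add_distrib]
    rw [bregman_separable (hF p hp)]
  have hda : ∀ q ∈ clippedSimplex ι c, ∀ i,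
      HasDerivAt (a i) (g i + (f' i (q i) - f' i (p i))) (q i) := by
    intro q hq i
    have h1 : HasDerivAt (fun x : ℝ => x * g i) (1 * g i) (q i) := (hasDerivAt_id _).mul_const _
    have h2 : HasDerivAt (fun x : ℝ => f' i (p i) * (x - p i)) (f' i (p i) * 1) (q i) :=
      ((hasDerivAt_id _).sub_const _).const_mul _
    have := h1.add (((hF q hq i).sub_const (f i (p i))).sub h2)
    rw [one_mul, mul_one] at this
    exact this
  have hdA : ∀ q ∈ clippedSimplex ι c, HasFDerivAt A (∑ i, (g i + (f' i (q i) - f' i (p i))) •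
      ContinuousLinearMap.proj (R := ℝ) (φ := fun _ : ι => ℝ) i) q := by
    intro q hq
    rw [hAa]
    exact hasFDerivAt_separable (f' := fun i _ => g i + (f' i (q i) - f' i (p i))) (hda q hq)
  have hcont : ContinuousOn A (clippedSimplex ι c) :=
    fun q hq => (hdA q hq).continuousAt.continuousWithinAt
  have hspec : p' ∈ clippedSimplex ι c ∧ IsMinOn A (clippedSimplex ι c) p' :=
    Classical.epsilon_spec ((isCompact_clippedSimplex c).exists_isMinOn ⟨p, hp⟩ hcont)
  refine ⟨hspec.1, fun u hu => ?_⟩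
  have hnn := (hspec.2.localize).hasFDerivWithinAt_nonneg
    (hdA p' hspec.1).hasFDerivWithinAt
    (sub_mem_posTangentConeAt_of_segment_subset
      ((convex_clippedSimplex c).segment_subset hspec.1 hu))
  rw [bregman_separable (hF p hp), bregman_separable (hF p' hspec.1),
    bregman_separable (hF p hp), ← sub_nonneg]
  simp only [sum_apply, smul_apply,
    ContinuousLinearMap.proj_apply, Pi.sub_apply, smul_eq_mul] at hnn
  refine hnn.trans (le_of_eq ?_)
  simp only [← Finset.sum_sub_distrib]
  exact Finset.sum_congr rfl fun i _ => by ring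

end Separable

/-- The scalar Itakura–Saito divergence, which is the Bregman divergence of `-log`. -/
def isDiv (x y : ℝ) : ℝ := x / y - 1 - Real.log (x / y)

/-- The scalar relative entropy, which is the Bregman divergence of `x log x - x`. -/
def klDiv (x y : ℝ) : ℝ := x * Real.log (x / y) - x + y

lemma isDiv_nonneg {x y : ℝ} (hx : 0 < x) (hy : 0 < y) : 0 ≤ isDiv x y := by
  have := Real.log_le_sub_one_of_pos (div_pos hx hy)
  simp only [isDiv]; linarith

lemma klDiv_nonneg {x y : ℝ} (hx : 0 < x) (hy : 0 < y) : 0 ≤ klDiv x y := by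
  have h := Real.log_le_sub_one_of_pos (div_pos hy hx)
  have h2 : Real.log (x / y) = -Real.log (y / x) := by rw [← Real.log_inv, inv_div]
  have h3 : x * Real.log (y / x) ≤ x * (y / x - 1) := by gcongr
  have h4 : x * (y / x - 1) = y - x := by field_simp
  simp only [klDiv, h2]; linarith

/-- Stability of the log-barrier: the gain from moving from `y` to `x` is paid for by the
divergence up to `ξ y² g²`. The loss `g` may be arbitrarily large because it is nonnegative. -/
lemma isDiv_stability {x y g ξ : ℝ} (hx : 0 < x) (hy : 0 < y) (hg : 0 ≤ g) (hξ : 0 < ξ) :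
    (y - x) * g - isDiv x y / ξ ≤ ξ * (y ^ 2 * g ^ 2) := by
  set w := ξ * y * g with hw
  have hw0 : 0 ≤ w := by positivity
  set z := x / y with hz
  have hz0 : 0 < z := div_pos hx hy
  have h1 := Real.log_le_sub_one_of_pos (show 0 < z * (1 + w) by positivity)
  rw [Real.log_mul hz0.ne' (by positivity)] at h1
  have h2 := Real.log_le_sub_one_of_pos (show 0 < (1 + w)⁻¹ by positivity)
  rw [Real.log_inv] at h2
  have h3 : w + (1 + w)⁻¹ - 1 ≤ w ^ 2 := by
    have : w + (1 + w)⁻¹ - 1 = w ^ 2 / (1 + w) := by field_simp; ring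
    rw [this]; exact div_le_self (by positivity) (by linarith)
  have h4 : w * (1 - z) - (z - 1 - Real.log z) ≤ w ^ 2 := by nlinarith
  have e1 : (y - x) * g = w * (1 - z) / ξ := by rw [hw, hz]; field_simp
  have e2 : ξ * (y ^ 2 * g ^ 2) = w ^ 2 / ξ := by rw [hw]; field_simp
  rw [e1, e2, isDiv, ← sub_div]
  gcongr

/-- Stability of the negative entropy, again for an arbitrarily large nonnegative loss. -/
lemma klDiv_stability {x y g η : ℝ} (hx : 0 < x) (hy : 0 < y) (hg : 0 ≤ g) (hη : 0 < η) :
    (y - x) * g - klDiv x y / η ≤ η * (y * g ^ 2) := by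
  set w := η * g with hw
  have hw0 : 0 ≤ w := by positivity
  have h1 := Real.log_le_sub_one_of_pos (show 0 < Real.exp (-w) / (x / y) by positivity)
  rw [Real.log_div (Real.exp_pos _).ne' (by positivity), Real.log_exp] at h1
  have h2 : x * (-w - Real.log (x / y)) ≤ x * (Real.exp (-w) / (x / y) - 1) := by gcongr
  have h3 : x * (Real.exp (-w) / (x / y) - 1) = y * Real.exp (-w) - x := by field_simp
  have h4 : Real.exp (-w) ≤ 1 - w + w ^ 2 := by
    have h5 : 1 + w ≤ Real.exp w := by linarith [Real.add_one_le_exp w]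
    rw [Real.exp_neg]
    refine (inv_anti₀ (by positivity) h5).trans ?_
    rw [inv_le_iff_one_le_mul₀ (by positivity)]
    nlinarith [pow_nonneg hw0 3]
  have h6 : y * Real.exp (-w) ≤ y * (1 - w + w ^ 2) := by gcongr
  have e1 : (y - x) * g = w * (y - x) / η := by rw [hw]; field_simp
  have e2 : η * (y * g ^ 2) = y * w ^ 2 / η := by rw [hw]; field_simp
  rw [e1, e2, klDiv, ← sub_div]
  gcongr
  nlinarith

section Steps

variable {ι : Type*} [Fintype ι] {c : ℝ} {p g : ι → ℝ}

lemma hasDerivAt_neg_log_div (ξ x : ℝ) (hx : 0 < x) :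
    HasDerivAt (fun x => -(Real.log x / ξ)) (-(x⁻¹ / ξ)) x :=
  ((Real.hasDerivAt_log hx.ne').div_const ξ).neg

lemma logBarrier_eq (ξ : ι → ℝ) :
    logBarrier ξ = fun p => ∑ i, -(Real.log (p i) / ξ i) := by
  funext p; simp [logBarrier]

lemma bregman_logBarrier (ξ : ι → ℝ) {u q : ι → ℝ} (hu : ∀ i, 0 < u i) (hq : ∀ i, 0 < q i) :
    bregman (logBarrier ξ) u q = ∑ i, isDiv (u i) (q i) / ξ i := by
  rw [logBarrier_eq, bregman_separable (f := fun i x => -(Real.log x / ξ i))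
    (f' := fun i x => -(x⁻¹ / ξ i)) fun i => hasDerivAt_neg_log_div (ξ i) _ (hq i)]
  refine Finset.sum_congr rfl fun i _ => ?_
  rw [isDiv, Real.log_div (hu i).ne' (hq i).ne']
  have := (hq i).ne'
  field_simp
  ring

lemma omdStep_logBarrier_mem (hc : 0 < c) (hp : p ∈ clippedSimplex ι c) (ξ g : ι → ℝ) :
    omdStep (clippedSimplex ι c) (logBarrier ξ) p g ∈ clippedSimplex ι c := by
  rw [logBarrier_eq]
  exact (omdStep_spec hc (fun i x hx => hasDerivAt_neg_log_div (ξ i) x hx) hp g).1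

/-- The regret of one step with the log-barrier. -/
lemma omdStep_logBarrier_regret (hc : 0 < c) (hp : p ∈ clippedSimplex ι c) {ξ : ι → ℝ}
    (hξ : ∀ i, 0 < ξ i) (hg : ∀ i, 0 ≤ g i) {u : ι → ℝ} (hu : u ∈ clippedSimplex ι c) :
    ∑ i, (p i - u i) * g i ≤ ∑ i, isDiv (u i) (p i) / ξ i
      - ∑ i, isDiv (u i) (omdStep (clippedSimplex ι c) (logBarrier ξ) p g i) / ξ i
      + ∑ i, ξ i * (p i ^ 2 * g i ^ 2) := by
  have h := omdStep_spec hc (fun i x hx => hasDerivAt_neg_log_div (ξ i) x hx) hp g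
  simp only at h
  rw [← logBarrier_eq] at h
  obtain ⟨hp', h⟩ := h
  set p' := omdStep (clippedSimplex ι c) (logBarrier ξ) p g
  have hpos : ∀ q ∈ clippedSimplex ι c, ∀ i, 0 < q i := fun q hq i => hc.trans_le (hq.2 i).1
  have h := h u hu
  rw [bregman_logBarrier ξ (hpos u hu) (hpos p hp), bregman_logBarrier ξ (hpos u hu) (hpos p' hp'),
    bregman_logBarrier ξ (hpos p' hp') (hpos p hp)] at h
  have hs : ∑ i, ((p i - p' i) * g i - isDiv (p' i) (p i) / ξ i) ≤
      ∑ i, ξ i * (p i ^ 2 * g i ^ 2) :=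
    Finset.sum_le_sum fun i _ => isDiv_stability (hpos p' hp' i) (hpos p hp i) (hg i) (hξ i)
  have hd : ∑ i, (p i - u i) * g i = ∑ i, (p i - p' i) * g i + ∑ i, (p' i - u i) * g i := by
    rw [← Finset.sum_add_distrib]; exact Finset.sum_congr rfl fun i _ => by ring
  rw [Finset.sum_sub_distrib] at hs
  linarith

lemma hasDerivAt_entropy (η x : ℝ) (hx : 0 < x) :
    HasDerivAt (fun x => (1 / η) * (x * Real.log x - x)) ((1 / η) * Real.log x) x := by
  have := ((Real.hasDerivAt_mul_log hx.ne').sub (hasDerivAt_id x)).const_mul (1 / η)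
  simpa using this

lemma negEntropy_eq (η : ℝ) :
    negEntropy (ι := ι) η = fun p => ∑ i, (1 / η) * (p i * Real.log (p i) - p i) := by
  funext p; rw [negEntropy, Finset.mul_sum]

lemma bregman_negEntropy (η : ℝ) {u q : ι → ℝ} (hu : ∀ i, 0 < u i) (hq : ∀ i, 0 < q i) :
    bregman (negEntropy η) u q = (∑ i, klDiv (u i) (q i)) / η := by
  rw [negEntropy_eq, bregman_separable (f := fun i x => (1 / η) * (x * Real.log x - x))
    (f' := fun i x => (1 / η) * Real.log x) fun i => hasDerivAt_entropy η _ (hq i),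
    Finset.sum_div]
  refine Finset.sum_congr rfl fun i _ => ?_
  rw [klDiv, Real.log_div (hu i).ne' (hq i).ne']
  ring

lemma omdStep_negEntropy_mem (hc : 0 < c) (hp : p ∈ clippedSimplex ι c) (η : ℝ) (g : ι → ℝ) :
    omdStep (clippedSimplex ι c) (negEntropy η) p g ∈ clippedSimplex ι c := by
  rw [negEntropy_eq]
  exact (omdStep_spec (f := fun _ x => (1 / η) * (x * Real.log x - x)) hc
    (fun i x hx => hasDerivAt_entropy η x hx) hp g).1

/-- The regret of one step with the negative entropy. -/
lemma omdStep_negEntropy_regret (hc : 0 < c) (hp : p ∈ clippedSimplex ι c) {η : ℝ}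
    (hη : 0 < η) (hg : ∀ i, 0 ≤ g i) {u : ι → ℝ} (hu : u ∈ clippedSimplex ι c) :
    ∑ i, (p i - u i) * g i ≤ (∑ i, klDiv (u i) (p i)
      - ∑ i, klDiv (u i) (omdStep (clippedSimplex ι c) (negEntropy η) p g i)) * (1 / η)
      + η * ∑ i, p i * g i ^ 2 := by
  have h := omdStep_spec (f := fun _ x => (1 / η) * (x * Real.log x - x)) hc
    (fun i x hx => hasDerivAt_entropy η x hx) hp g
  simp only at h
  rw [← negEntropy_eq] at h
  obtain ⟨hp', h⟩ := h
  set p' := omdStep (clippedSimplex ι c) (negEntropy η) p g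
  have hpos : ∀ q ∈ clippedSimplex ι c, ∀ i, 0 < q i := fun q hq i => hc.trans_le (hq.2 i).1
  have h := h u hu
  rw [bregman_negEntropy η (hpos u hu) (hpos p hp), bregman_negEntropy η (hpos u hu) (hpos p' hp'),
    bregman_negEntropy η (hpos p' hp') (hpos p hp)] at h
  have hs : ∑ i, ((p i - p' i) * g i - klDiv (p' i) (p i) / η) ≤
      ∑ i, η * (p i * g i ^ 2) :=
    Finset.sum_le_sum fun i _ => klDiv_stability (hpos p' hp' i) (hpos p hp i) (hg i) hη
  have hd : ∑ i, (p i - u i) * g i = ∑ i, (p i - p' i) * g i + ∑ i, (p' i - u i) * g i := by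
    rw [← Finset.sum_add_distrib]; exact Finset.sum_congr rfl fun i _ => by ring
  rw [Finset.sum_sub_distrib, ← Finset.mul_sum, ← Finset.sum_div] at hs
  rw [sub_mul, mul_one_div, mul_one_div]
  linarith

end Steps

/-! ### Expectations over the draws -/

section Sequential

variable {T : ℕ} {Z : Type*} [Fintype Z]

lemma sum_sum_update (k : Fin T) (f : (Fin T → Z) → ℝ) :
    ∑ ω : Fin T → Z, ∑ z, f (Function.update ω k z) = Fintype.card Z * ∑ ω, f ω := by
  classical
  rw [← Fintype.sum_prod_type' (f := fun (ω : Fin T → Z) z => f (Function.update ω k z))]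
  -- exchanging `ω k` with `z` is an involution of the pairs `(ω, z)`
  let e : (Fin T → Z) × Z → (Fin T → Z) × Z := fun x => (Function.update x.1 k x.2, x.1 k)
  have he : Function.Involutive e := by
    rintro ⟨ω, z⟩
    simp [e]
  have := he.bijective.sum_comp (fun x : (Fin T → Z) × Z => f x.1)
  simp only [e] at this
  rw [this, Fintype.sum_prod_type, Finset.mul_sum]
  simp

/-- The expectation over the first `k` draws, while the others are averaged uniformly. -/
def partialExpect (w : ℕ → (Fin T → Z) → Z → ℝ) (k : ℕ) (X : (Fin T → Z) → ℝ) : ℝ :=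
  ∑ ω, (∏ s : Fin T, if (s : ℕ) < k then w s ω (ω s) else (Fintype.card Z : ℝ)⁻¹) * X ω

variable [Nonempty Z] {w : ℕ → (Fin T → Z) → Z → ℝ}

lemma partialExpect_succ (hw : ∀ t : ℕ, DependsOn (w t) {s : Fin T | (s : ℕ) < t}) (k : Fin T)
    {Y : (Fin T → Z) → Z → ℝ} (hY : DependsOn Y {s : Fin T | s < k}) :
    partialExpect w (k + 1) (fun ω => Y ω (ω k)) =
      partialExpect w k (fun ω => ∑ z, w k ω z * Y ω z) := by
  classical
  have hZ : (Fintype.card Z : ℝ) ≠ 0 := by simp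
  have hupd : ∀ (ω : Fin T → Z) z (s : Fin T), s ≠ k → Function.update ω k z s = ω s :=
    fun ω z s hs => Function.update_of_ne hs _ _
  have hwu : ∀ (ω : Fin T → Z) z (s : Fin T), s ≤ k → w s (Function.update ω k z) = w s ω := by
    intro ω z s hs
    refine hw s fun i (hi : (i : ℕ) < s) => hupd ω z i ?_
    rintro rfl
    exact absurd hs (not_le.2 hi)
  have hYu : ∀ (ω : Fin T → Z) z, Y (Function.update ω k z) = Y ω :=
    fun ω z => hY fun i (hi : i < k) => hupd ω z i hi.ne
  have h := sum_sum_update k fun ω : Fin T → Z =>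
    (∏ s : Fin T, if (s : ℕ) < (k : ℕ) + 1 then w s ω (ω s) else (Fintype.card Z : ℝ)⁻¹) * Y ω (ω k)
  rw [partialExpect, partialExpect, ← mul_right_inj' hZ, ← h, Finset.mul_sum]
  refine Finset.sum_congr rfl fun ω _ => ?_
  have hprod : ∀ z, (∏ s : Fin T, if (s : ℕ) < (k : ℕ) + 1 then
      w s (Function.update ω k z) (Function.update ω k z s) else (Fintype.card Z : ℝ)⁻¹) =
      w k ω z * ∏ s ∈ Finset.univ.erase k, if (s : ℕ) < (k : ℕ) then w s ω (ω s)
        else (Fintype.card Z : ℝ)⁻¹ := by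
    intro z
    rw [← Finset.mul_prod_erase _ _ (Finset.mem_univ k)]
    congr 1
    · simp [hwu ω z k le_rfl]
    · refine Finset.prod_congr rfl fun s hs => ?_
      have hsk : s ≠ k := Finset.ne_of_mem_erase hs
      have hsk' : (s : ℕ) ≠ k := fun h => hsk (Fin.ext h)
      by_cases hlt : (s : ℕ) < k
      · rw [if_pos (by omega), if_pos hlt, hwu ω z s (le_of_lt hlt), hupd ω z s hsk]
      · rw [if_neg (by omega), if_neg hlt]
  have hprod' : (∏ s : Fin T, if (s : ℕ) < (k : ℕ) then w s ω (ω s)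
      else (Fintype.card Z : ℝ)⁻¹) = (Fintype.card Z : ℝ)⁻¹ *
        ∏ s ∈ Finset.univ.erase k, if (s : ℕ) < (k : ℕ) then w s ω (ω s)
          else (Fintype.card Z : ℝ)⁻¹ := by
    rw [← Finset.mul_prod_erase _ _ (Finset.mem_univ k)]
    simp
  rw [hprod']
  simp only [hprod, hYu, Function.update_self]
  rw [mul_assoc, mul_inv_cancel_left₀ hZ, Finset.mul_sum]
  exact Finset.sum_congr rfl fun z _ => by ring

lemma partialExpect_of_le (hw : ∀ t : ℕ, DependsOn (w t) {s : Fin T | (s : ℕ) < t})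
    (hw1 : ∀ t ω, ∑ z, w t ω z = 1) {k : ℕ} {X : (Fin T → Z) → ℝ}
    (hX : DependsOn X {s : Fin T | (s : ℕ) < k}) {j : ℕ} (hkj : k ≤ j) (hj : j ≤ T) :
    partialExpect w j X = partialExpect w k X := by
  induction j, hkj using Nat.le_induction with
  | base => rfl
  | succ j hkj ih =>
    rw [← ih (by omega)]
    have := partialExpect_succ hw ⟨j, hj⟩ (Y := fun ω _ => X ω) (fun x y h => by
      funext z
      exact hX fun i (hi : (i : ℕ) < k) => h i (Fin.mk_lt_mk.2 (hi.trans_le hkj) : i < ⟨j, hj⟩))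
    simpa [← Finset.sum_mul, hw1] using this

/-- Conditioning on the past: the `k`-th draw may be averaged with its conditional weights. -/
lemma partialExpect_draw (hw : ∀ t : ℕ, DependsOn (w t) {s : Fin T | (s : ℕ) < t})
    (hw1 : ∀ t ω, ∑ z, w t ω z = 1) (k : Fin T)
    {Y : (Fin T → Z) → Z → ℝ} (hY : DependsOn Y {s : Fin T | s < k}) :
    partialExpect w T (fun ω => Y ω (ω k)) =
      partialExpect w T (fun ω => ∑ z, w k ω z * Y ω z) := by
  rw [partialExpect_of_le hw hw1 (k := k + 1) _ k.2 le_rfl, partialExpect_succ hw k hY,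
    partialExpect_of_le hw hw1 (k := k) _ k.2.le le_rfl]
  · intro x y h
    have h1 := hw k h
    have h2 := hY h
    simp only [h1, h2]
  · intro x y h
    have h2 : Y x = Y y := hY fun i hi => h i (Nat.lt_succ_of_lt hi)
    have h3 : x k = y k := h k (Nat.lt_succ_self _)
    simp only [h2, h3]

end Sequential

variable {T K : ℕ}

/-- The conditional probability of the draws of a round, given the state. -/
def drawProb (s : State T K) (z : Base T × Fin K) : ℝ := s.p z.1 * s.q z.1 z.2

lemma stateAt_dependsOn (η : ℝ) (l : Fin T → Fin K → ℝ) (t : ℕ) :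
    DependsOn (fun ω => stateAt η l ω t) {s : Fin T | (s : ℕ) < t} := by
  induction t with
  | zero => intro x y _; rfl
  | succ t ih =>
    intro x y h
    have h1 : stateAt η l x t = stateAt η l y t :=
      ih fun i (hi : (i : ℕ) < t) => h i (Nat.lt_succ_of_lt hi)
    simp only [stateAt]
    split_ifs with ht
    · have h2 : x ⟨t, ht⟩ = y ⟨t, ht⟩ := h _ (Nat.lt_succ_self _)
      rw [h1, h2]
    · exact h1

section Expect

variable {η : ℝ} {l : Fin T → Fin K → ℝ}

lemma expect_eq_partialExpect (X : History T K → ℝ) :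
    expect η l X = partialExpect (fun t ω => drawProb (stateAt η l ω t)) T X := by
  simp [expect, partialExpect, prob, drawProb]

/-- The draws of round `t` may be averaged with their probabilities given the state. -/
lemma expect_draw [NeZero K] (h1 : ∀ ω t, ∑ z, drawProb (stateAt η l ω t) z = 1) (t : Fin T)
    (X : State T K → Base T × Fin K → ℝ) :
    expect η l (fun ω => X (stateAt η l ω t) (ω t)) =
      expect η l (fun ω => ∑ z, drawProb (stateAt η l ω t) z * X (stateAt η l ω t) z) := by
  rw [expect_eq_partialExpect, expect_eq_partialExpect]
  refine partialExpect_draw (w := fun t ω => drawProb (stateAt η l ω t))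
    (fun t x y h => ?_) (fun t ω => h1 ω t) t
    (Y := fun ω z => X (stateAt η l ω t) z) fun x y h => ?_
  · have := stateAt_dependsOn η l t h
    simp only at this ⊢
    rw [this]
  · have := stateAt_dependsOn η l t (x := x) (y := y) fun i hi => h i hi
    simp only at this ⊢
    rw [this]

lemma expect_const [NeZero K] (h1 : ∀ ω t, ∑ z, drawProb (stateAt η l ω t) z = 1) (c : ℝ) :
    expect η l (fun _ => c) = c := by
  rw [expect_eq_partialExpect, partialExpect_of_le (k := 0) _ (fun t ω => h1 ω t) _
    (Nat.zero_le T) le_rfl]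
  · have hK : (K : ℝ) ≠ 0 := NeZero.ne _
    have hH : (numBases T : ℝ) ≠ 0 := NeZero.ne _
    have h : (numBases T : ℝ) * K * ((K : ℝ)⁻¹ * (numBases T : ℝ)⁻¹) = 1 := by field_simp
    simp [partialExpect, ← mul_assoc, ← mul_pow, h]
  · intro t x y h
    have := stateAt_dependsOn η l t h
    simp only at this ⊢
    rw [this]
  · intro x y _; rfl

lemma expect_add (X Y : History T K → ℝ) :
    expect η l (fun ω => X ω + Y ω) = expect η l X + expect η l Y := by
  simp [expect, mul_add, Finset.sum_add_distrib]

lemma expect_sub (X Y : History T K → ℝ) :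
    expect η l (fun ω => X ω - Y ω) = expect η l X - expect η l Y := by
  simp [expect, mul_sub, Finset.sum_sub_distrib]

lemma expect_const_mul (c : ℝ) (X : History T K → ℝ) :
    expect η l (fun ω => c * X ω) = c * expect η l X := by
  simp only [expect, Finset.mul_sum]
  exact Finset.sum_congr rfl fun ω _ => by ring

lemma expect_sum {ι : Type*} (s : Finset ι) (X : ι → History T K → ℝ) :
    expect η l (fun ω => ∑ i ∈ s, X i ω) = ∑ i ∈ s, expect η l (X i) := by
  simp only [expect, Finset.mul_sum]
  exact Finset.sum_comm

lemma expect_mono (h0 : ∀ ω t z, 0 ≤ drawProb (stateAt η l ω t) z) {X Y : History T K → ℝ}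
    (h : ∀ ω, X ω ≤ Y ω) : expect η l X ≤ expect η l Y :=
  Finset.sum_le_sum fun ω _ =>
    mul_le_mul_of_nonneg_left (h ω) (Finset.prod_nonneg fun t _ => h0 ω t (ω t))

end Expect

/-! ### Invariants of the states -/

/-- What holds for every state that the algorithm reaches. The bound on the learning rates `ξ`
expresses that every increase by the factor `e ^ (1 / log T)` comes with a doubling of `ρ`. -/
structure State.Invariant (η : ℝ) (s : State T K) : Prop where
  p_mem : s.p ∈ clippedSimplex (Base T) (1 / ((T : ℝ) * (numBases T : ℝ)))
  q_mem : ∀ h, s.q h ∈ clippedSimplex (Fin K) (1 / ((T : ℝ) * (K : ℝ)))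
  inv_p_le : ∀ h, 1 / s.p h ≤ s.rho h
  le_rho : ∀ h, 2 * (numBases T : ℝ) ≤ s.rho h
  rho_le : ∀ h, s.rho h ≤ 2 * ((T : ℝ) * (numBases T : ℝ))
  le_xi : ∀ h, η ≤ s.xi h
  xi_le : ∀ h, s.xi h ≤ η * Real.exp (2 * Real.log (s.rho h / (2 * numBases T)) / Real.log T)

lemma numBases_ge_one (T : ℕ) : (1 : ℝ) ≤ numBases T := by
  exact_mod_cast Nat.one_le_iff_ne_zero.2 (NeZero.ne _)

lemma half_le_log_two : (1 / 2 : ℝ) ≤ Real.log 2 := by linarith [Real.log_two_gt_d9]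

lemma half_le_log (hT : 2 ≤ T) : (1 / 2 : ℝ) ≤ Real.log T :=
  half_le_log_two.trans (Real.log_le_log (by norm_num) (by exact_mod_cast hT))

lemma uniform_mem_clippedSimplex {ι : Type*} [Fintype ι] (hT : 2 ≤ T) {n : ℕ}
    (hn : Fintype.card ι = n) (hn1 : 1 ≤ n) :
    (fun _ : ι => 1 / (n : ℝ)) ∈ clippedSimplex ι (1 / ((T : ℝ) * (n : ℝ))) := by
  have h1 : (1 : ℝ) ≤ n := by exact_mod_cast hn1
  have h2 : (1 : ℝ) ≤ T := by exact_mod_cast (by omega : 1 ≤ T)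
  refine ⟨?_, fun i => ⟨?_, ?_⟩⟩
  · simp only [Finset.sum_const, Finset.card_univ, hn, nsmul_eq_mul]
    field_simp
  · exact one_div_le_one_div_of_le (by positivity) (by nlinarith)
  · rw [div_le_one (by positivity)]; exact h1

lemma invariant_init (hT : 2 ≤ T) (hK : 1 ≤ K) {η : ℝ} :
    (initState T K η).Invariant η := by
  have hH := numBases_ge_one T
  have h2 : (1 : ℝ) ≤ T := by exact_mod_cast (by omega : 1 ≤ T)
  refine ⟨?_, fun h => ?_, fun h => ?_, fun h => ?_, fun h => ?_, fun h => ?_, fun h => ?_⟩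
  · exact uniform_mem_clippedSimplex hT (by simp) (by exact_mod_cast hH)
  · exact uniform_mem_clippedSimplex hT (by simp) hK
  · simp only [initState, one_div_one_div]; linarith
  · exact le_rfl
  · simp only [initState]; nlinarith
  · exact le_rfl
  · simp only [initState]
    rw [div_self (by positivity)]
    simp

lemma clip_pos {n : ℕ} (hT : 2 ≤ T) (hn : (1 : ℝ) ≤ n) : (0 : ℝ) < 1 / ((T : ℝ) * (n : ℝ)) := by
  have h2 : (2 : ℝ) ≤ T := by exact_mod_cast hT
  positivity

lemma State.Invariant.p_pos {η : ℝ} {s : State T K} (hs : s.Invariant η) (hT : 2 ≤ T)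
    (h : Base T) : 0 < s.p h :=
  (clip_pos hT (numBases_ge_one T)).trans_le (hs.p_mem.2 h).1

lemma State.Invariant.q_pos {η : ℝ} {s : State T K} (hs : s.Invariant η) (hT : 2 ≤ T)
    (hK : 1 ≤ K) (h : Base T) (a : Fin K) : 0 < s.q h a :=
  (clip_pos hT (by exact_mod_cast hK)).trans_le ((hs.q_mem h).2 a).1

lemma State.Invariant.rho_pos {η : ℝ} {s : State T K} (hs : s.Invariant η)
    (h : Base T) : 0 < s.rho h := by
  linarith [hs.le_rho h, numBases_ge_one T]

lemma State.Invariant.xi_le_eight_mul {η : ℝ} {s : State T K} (hs : s.Invariant η) (hT : 2 ≤ T)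
    (hη : 0 < η) (h : Base T) : s.xi h ≤ 8 * η := by
  have hH := numBases_ge_one T
  have hlog := half_le_log hT
  have hρ := hs.rho_pos h
  have h1 : s.rho h / (2 * numBases T) ≤ T := by
    rw [div_le_iff₀ (by positivity)]
    linarith [hs.rho_le h]
  have h2 : 2 * Real.log (s.rho h / (2 * numBases T)) / Real.log T ≤ 2 := by
    rw [div_le_iff₀ (by linarith)]
    linarith [Real.log_le_log (by positivity) h1]
  have h3 : Real.exp 2 ≤ 8 := by
    have h4 := Real.exp_one_lt_d9
    have h5 : Real.exp 2 = Real.exp 1 ^ 2 := by rw [← Real.exp_nat_mul]; norm_num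
    rw [h5]
    nlinarith [Real.exp_pos 1]
  calc s.xi h ≤ _ := hs.xi_le h
    _ ≤ η * 8 := by gcongr; exact (Real.exp_le_exp.2 h2).trans h3
    _ = 8 * η := mul_comm _ _

lemma nextP_mem (hT : 2 ≤ T) {η : ℝ} {s : State T K} (hs : s.Invariant η) (h₀ : Base T) (x : ℝ) :
    nextP s h₀ x ∈ clippedSimplex (Base T) (1 / ((T : ℝ) * (numBases T : ℝ))) :=
  omdStep_logBarrier_mem (clip_pos hT (numBases_ge_one T)) hs.p_mem _ _

lemma nextQ_mem (hT : 2 ≤ T) (hK : 1 ≤ K) {η : ℝ} {s : State T K} (hs : s.Invariant η)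
    (h₀ : Base T) (a₀ : Fin K) (x : ℝ) (h : Base T) :
    nextQ s h₀ a₀ x h ∈ clippedSimplex (Fin K) (1 / ((T : ℝ) * (K : ℝ))) :=
  omdStep_negEntropy_mem (clip_pos hT (by exact_mod_cast hK)) (hs.q_mem h) _ _

lemma rho_le_step (hT : 2 ≤ T) {η : ℝ} {s : State T K} (hs : s.Invariant η) (h₀ : Base T)
    (a₀ : Fin K) (x : ℝ) (h : Base T) : s.rho h ≤ (step s h₀ a₀ x).rho h := by
  have hp : 0 < nextP s h₀ x h :=
    (clip_pos hT (numBases_ge_one T)).trans_le ((nextP_mem hT hs h₀ x).2 h).1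
  simp only [step]
  split_ifs with hc
  · refine hc.le.trans ?_
    gcongr
    norm_num
  · exact le_rfl

lemma xi_le_step (hT : 2 ≤ T) {η : ℝ} (hη : 0 < η) {s : State T K} (hs : s.Invariant η)
    (h₀ : Base T) (a₀ : Fin K) (x : ℝ) (h : Base T) : s.xi h ≤ (step s h₀ a₀ x).xi h := by
  have hlog := half_le_log hT
  simp only [step]
  split_ifs with hc
  · exact le_mul_of_one_le_left (hη.le.trans (hs.le_xi h)) (Real.one_le_exp (by positivity))
  · exact le_rfl

lemma invariant_step (hT : 2 ≤ T) (hK : 1 ≤ K) {η : ℝ} (hη : 0 < η) {s : State T K}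
    (hs : s.Invariant η) (h₀ : Base T) (a₀ : Fin K) (x : ℝ) :
    (step s h₀ a₀ x).Invariant η := by
  have hH := numBases_ge_one T
  have hlog := half_le_log hT
  have hmem := nextP_mem hT hs h₀ x
  have hp : ∀ h, 0 < nextP s h₀ x h := fun h => (clip_pos hT hH).trans_le (hmem.2 h).1
  refine ⟨hmem, fun h => nextQ_mem hT hK hs h₀ a₀ x h, fun h => ?_,
    fun h => (hs.le_rho h).trans (rho_le_step hT hs h₀ a₀ x h), fun h => ?_,
    fun h => (hs.le_xi h).trans (xi_le_step hT hη hs h₀ a₀ x h), fun h => ?_⟩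
  · have := hp h
    simp only [step]
    split_ifs with hc
    · gcongr
      norm_num
    · exact not_lt.1 hc
  · simp only [step]
    split_ifs with hc
    · have h1 := (hmem.2 h).1
      have h2 : (2 : ℝ) ≤ T := by exact_mod_cast hT
      rw [div_le_iff₀ (hp h)]
      rw [div_le_iff₀ (by positivity)] at h1
      linarith
    · exact hs.rho_le h
  · simp only [step]
    split_ifs with hc
    · have hρ := hs.rho_pos h
      have hp' := hp h
      have h1 : 2 * (s.rho h / (2 * numBases T)) ≤ 2 / nextP s h₀ x h / (2 * numBases T) := by
        rw [← mul_div_assoc]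
        have : 2 * s.rho h ≤ 2 / nextP s h₀ x h := by
          have : 2 / nextP s h₀ x h = 2 * (1 / nextP s h₀ x h) := by ring
          linarith
        gcongr
      have h2 := Real.log_le_log (by positivity) h1
      rw [Real.log_mul (by norm_num) (by positivity)] at h2
      calc _ ≤ Real.exp (1 / Real.log T) *
            (η * Real.exp (2 * Real.log (s.rho h / (2 * numBases T)) / Real.log T)) := by
            gcongr; exact hs.xi_le h
        _ = η * Real.exp ((1 + 2 * Real.log (s.rho h / (2 * numBases T))) / Real.log T) := by
            rw [add_div, Real.exp_add]; ring
        _ ≤ _ := by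
            gcongr
            linarith [half_le_log_two]
    · exact hs.xi_le h

lemma invariant_stateAt (hT : 2 ≤ T) (hK : 1 ≤ K) {η : ℝ} (hη : 0 < η)
    (l : Fin T → Fin K → ℝ) (ω : History T K) (t : ℕ) : (stateAt η l ω t).Invariant η := by
  induction t with
  | zero => exact invariant_init hT hK
  | succ t ih =>
    simp only [stateAt]
    split_ifs
    · exact invariant_step hT hK hη ih _ _ _
    · exact ih

lemma stateAt_succ (η : ℝ) (l : Fin T → Fin K → ℝ) (ω : History T K) (t : Fin T) :
    stateAt η l ω (t + 1) = step (stateAt η l ω t) (ω t).1 (ω t).2 (l t (ω t).2) := by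
  simp [stateAt]

lemma rho_stateAt_mono (hT : 2 ≤ T) (hK : 1 ≤ K) {η : ℝ} (hη : 0 < η)
    (l : Fin T → Fin K → ℝ) (ω : History T K) (h : Base T) :
    Monotone fun t => (stateAt η l ω t).rho h := by
  refine monotone_nat_of_le_succ fun t => ?_
  by_cases ht : t < T
  · have := stateAt_succ η l ω ⟨t, ht⟩
    simp only at this
    rw [this]
    exact rho_le_step hT (invariant_stateAt hT hK hη l ω t) _ _ _ _
  · simp [stateAt, ht]

/-! ### The regret of the master -/

/-- The potential of the master against the comparator `u`: the divergence of `u` from the current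
distribution, together with a reserve that is linear in `ρ(h)`. -/
def masterPotential (η : ℝ) (u : Base T → ℝ) (h : Base T) (s : State T K) : ℝ :=
  ∑ i, isDiv (u i) (s.p i) / s.xi i +
    max 0 (1 / (8 * η * (1 + Real.log T)) * (s.rho h / 8 - 1))

lemma half_sub_one_le_isDiv {y : ℝ} (hy : 0 < y) : y / 2 - 1 ≤ y - 1 - Real.log y := by
  have h1 := Real.log_le_sub_one_of_pos (show 0 < y / 2 by positivity)
  rw [Real.log_div hy.ne' (by norm_num)] at h1
  linarith [Real.log_two_lt_d9]

/-- When `ρ(h)` is increased, the divergence in coordinate `h` is large, of the order of the new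
`ρ(h)`, and the simultaneous increase of the learning rate turns a fraction of it into a gain. -/
lemma isDiv_div_xi_step (hT : 2 ≤ T) {η : ℝ} (hη : 0 < η) {ξ p u : ℝ} (hξ : 0 < ξ)
    (hξ' : ξ ≤ 8 * η) (hp : 0 < p) (hu : 1 / 2 ≤ u) :
    isDiv u p / (Real.exp (1 / Real.log T) * ξ) +
        max 0 (1 / (8 * η * (1 + Real.log T)) * (2 / p / 8 - 1)) ≤ isDiv u p / ξ := by
  have hlog := half_le_log hT
  set L := Real.log T
  have hL : 0 < L := by linarith
  have hd := isDiv_nonneg (show 0 < u by linarith) hp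
  have h1 : 2 / p / 8 - 1 ≤ isDiv u p := by
    have h2 := half_sub_one_le_isDiv (show 0 < u / p from div_pos (by linarith) hp)
    have h3 : (1 / 2) / p ≤ u / p := by gcongr
    have h4 : 2 / p = 4 * ((1 / 2) / p) := by ring
    simp only [isDiv]
    linarith
  have h5 : 1 / (8 * η * (1 + L)) * isDiv u p ≤
      isDiv u p / ξ - isDiv u p / (Real.exp (1 / L) * ξ) := by
    have h6 : 1 + 1 / L ≤ Real.exp (1 / L) := by linarith [Real.add_one_le_exp (1 / L)]
    have h7 : isDiv u p / (Real.exp (1 / L) * ξ) ≤ isDiv u p / ((1 + 1 / L) * ξ) := by gcongr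
    have h8 : isDiv u p / ξ - isDiv u p / ((1 + 1 / L) * ξ) = isDiv u p / (ξ * (1 + L)) := by
      field_simp
      ring
    have h9 : isDiv u p / (8 * η * (1 + L)) ≤ isDiv u p / (ξ * (1 + L)) := by gcongr
    rw [one_div_mul_eq_div]
    linarith
  have h10 : max 0 (1 / (8 * η * (1 + L)) * (2 / p / 8 - 1)) ≤
      1 / (8 * η * (1 + L)) * isDiv u p := by
    refine max_le (by positivity) ?_
    gcongr
  linarith

lemma master_step (hT : 2 ≤ T) {η : ℝ} (hη : 0 < η) {s : State T K}
    (hs : s.Invariant η) {u : Base T → ℝ}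
    (hu : u ∈ clippedSimplex (Base T) (1 / ((T : ℝ) * (numBases T : ℝ)))) {h : Base T}
    (huh : 1 / 2 ≤ u h) (h₀ : Base T) (a₀ : Fin K) {x : ℝ} (hx : x ∈ Set.Icc (0 : ℝ) 1) :
    ∑ i, (s.p i - u i) * baseLossEst s h₀ x i ≤
      masterPotential η u h s - masterPotential η u h (step s h₀ a₀ x) + 8 * η := by
  have hc := clip_pos hT (numBases_ge_one T)
  have hxi : ∀ i, 0 < s.xi i := fun i => hη.trans_le (hs.le_xi i)
  have hmem := nextP_mem hT hs h₀ x
  have hp' : ∀ i, 0 < nextP s h₀ x i := fun i => hc.trans_le (hmem.2 i).1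
  have hu0 : ∀ i, 0 < u i := fun i => hc.trans_le (hu.2 i).1
  have hg : ∀ i, 0 ≤ baseLossEst s h₀ x i := by
    intro i
    have := hs.p_pos hT i
    simp only [baseLossEst]
    split_ifs
    · exact div_nonneg hx.1 this.le
    · exact le_rfl
  have hreg := omdStep_logBarrier_regret hc hs.p_mem hxi hg hu
  have hvar : ∑ i, s.xi i * (s.p i ^ 2 * baseLossEst s h₀ x i ^ 2) ≤ 8 * η := by
    rw [Finset.sum_eq_single h₀ (fun i _ hi => by simp [baseLossEst, hi]) (by simp)]
    have hp0 := hs.p_pos hT h₀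
    have h1 : s.p h₀ ^ 2 * baseLossEst s h₀ x h₀ ^ 2 = x ^ 2 := by
      simp only [baseLossEst, if_true]
      field_simp
    have h2 : x ^ 2 ≤ 1 := pow_le_one₀ hx.1 hx.2
    rw [h1]
    exact (mul_le_of_le_one_right (hxi h₀).le h2).trans (hs.xi_le_eight_mul hT hη h₀)
  have hterm : ∀ i, isDiv (u i) (nextP s h₀ x i) / (step s h₀ a₀ x).xi i ≤
      isDiv (u i) (nextP s h₀ x i) / s.xi i := by
    intro i
    have := isDiv_nonneg (hu0 i) (hp' i)
    have := hxi i
    have := xi_le_step hT hη hs h₀ a₀ x i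
    gcongr
  have hpot : masterPotential η u h (step s h₀ a₀ x) ≤
      ∑ i, isDiv (u i) (nextP s h₀ x i) / s.xi i +
        max 0 (1 / (8 * η * (1 + Real.log T)) * (s.rho h / 8 - 1)) := by
    rw [masterPotential, ← Finset.add_sum_erase _ _ (Finset.mem_univ h),
      ← Finset.add_sum_erase _ _ (Finset.mem_univ h)]
    have hrest := Finset.sum_le_sum fun i (_ : i ∈ Finset.univ.erase h) => hterm i
    have hpe : (step s h₀ a₀ x).p = nextP s h₀ x := rfl
    rw [hpe]
    by_cases hcase : s.rho h < 1 / nextP s h₀ x h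
    · have e1 : (step s h₀ a₀ x).xi h = Real.exp (1 / Real.log T) * s.xi h := by
        simp only [step, if_pos hcase]
      have e2 : (step s h₀ a₀ x).rho h = 2 / nextP s h₀ x h := by
        simp only [step, if_pos hcase]
      have := isDiv_div_xi_step hT hη (hxi h) (hs.xi_le_eight_mul hT hη h) (hp' h) huh
      have h0 : 0 ≤ max 0 (1 / (8 * η * (1 + Real.log T)) * (s.rho h / 8 - 1)) :=
        le_max_left _ _
      rw [e1, e2]
      linarith
    · have e2 : (step s h₀ a₀ x).rho h = s.rho h := by
        simp only [step, if_neg hcase]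
      rw [e2]
      linarith [hterm h]
  have he : omdStep (clippedSimplex (Base T) (1 / ((T : ℝ) * (numBases T : ℝ))))
    (logBarrier s.xi) s.p (baseLossEst s h₀ x) = nextP s h₀ x := rfl
  rw [he] at hreg
  have hdef : masterPotential η u h s = ∑ i, isDiv (u i) (s.p i) / s.xi i +
    max 0 (1 / (8 * η * (1 + Real.log T)) * (s.rho h / 8 - 1)) := rfl
  linarith

/-- The vertex `e_i`, moved into the clipped simplex by mixing in `1 / T` of the uniform
distribution. -/
def clippedVertex (T : ℕ) {n : ℕ} (i j : Fin n) : ℝ :=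
  (if j = i then 1 - 1 / (T : ℝ) else 0) + 1 / ((T : ℝ) * n)

lemma clippedVertex_mem (hT : 2 ≤ T) {n : ℕ} (i : Fin n) :
    clippedVertex T i ∈ clippedSimplex (Fin n) (1 / ((T : ℝ) * (n : ℝ))) := by
  have h2 : (2 : ℝ) ≤ T := by exact_mod_cast hT
  have hn : (1 : ℝ) ≤ n := by exact_mod_cast (Fin.pos i)
  have h3 : 1 / (T : ℝ) ≤ 1 := by rw [div_le_one (by positivity)]; linarith
  have h4 : 1 / ((T : ℝ) * n) ≤ 1 / T := by gcongr; nlinarith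
  refine ⟨?_, fun j => ⟨?_, ?_⟩⟩
  · simp only [clippedVertex, Finset.sum_add_distrib, Finset.sum_ite_eq', Finset.mem_univ, if_true,
      Finset.sum_const, Finset.card_univ, Fintype.card_fin, nsmul_eq_mul]
    field_simp
    ring
  · simp only [clippedVertex]; split_ifs <;> linarith
  · simp only [clippedVertex]; split_ifs <;> linarith

lemma half_le_clippedVertex_self (hT : 2 ≤ T) {n : ℕ} (i : Fin n) :
    1 / 2 ≤ clippedVertex T i i := by
  have h2 : (2 : ℝ) ≤ T := by exact_mod_cast hT
  have h3 : 1 / (T : ℝ) ≤ 1 / 2 := by gcongr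
  have h4 : 0 ≤ 1 / ((T : ℝ) * n) := by positivity
  simp only [clippedVertex, if_true]
  linarith

lemma isDiv_clippedVertex_init (hT : 2 ≤ T) (h i : Base T) :
    isDiv (clippedVertex T h i) (1 / (numBases T : ℝ)) ≤
      (if i = h then (numBases T : ℝ) else 0) + Real.log T := by
  have h2 : (2 : ℝ) ≤ T := by exact_mod_cast hT
  have hH := numBases_ge_one T
  have hlog := half_le_log hT
  have h3 : 1 / (T : ℝ) ≤ 1 := by rw [div_le_one (by positivity)]; linarith
  have h5 : clippedVertex T h i / (1 / (numBases T : ℝ)) =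
      (if i = h then (1 - 1 / (T : ℝ)) * numBases T else 0) + 1 / T := by
    simp only [clippedVertex]
    split_ifs
    · field_simp
    · rw [zero_add, zero_add]
      field_simp
  rw [isDiv, h5]
  split_ifs with hi
  · have h6 : 1 ≤ (1 - 1 / (T : ℝ)) * numBases T + 1 / T := by nlinarith
    have h7 := Real.log_nonneg h6
    have h8 : 0 ≤ 1 / (T : ℝ) * numBases T := by positivity
    linarith
  · rw [zero_add, one_div, Real.log_inv, ← one_div]
    linarith

lemma masterPotential_init (hT : 2 ≤ T) {η : ℝ} (hη : 0 < η) (h : Base T) :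
    masterPotential η (clippedVertex T h) h (initState T K η) +
      1 / (8 * η * (1 + Real.log T)) ≤ numBases T * (Real.log T + 2) / η := by
  have hH := numBases_ge_one T
  have hlog := half_le_log hT
  have h1 : ∑ i, isDiv (clippedVertex T h i) (1 / (numBases T : ℝ)) / η ≤
      numBases T * (Real.log T + 1) / η := by
    rw [← Finset.sum_div]
    gcongr
    refine (Finset.sum_le_sum fun i _ => isDiv_clippedVertex_init hT h i).trans (le_of_eq ?_)
    simp [Finset.sum_add_distrib]
    ring
  have h3 : 1 / (8 * η * (1 + Real.log T)) ≤ 1 / (8 * η) := by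
    exact one_div_le_one_div_of_le (by positivity)
      (le_mul_of_one_le_right (by positivity) (by linarith))
  have h2 : max 0 (1 / (8 * η * (1 + Real.log T)) * (2 * (numBases T : ℝ) / 8 - 1)) ≤
      1 / (8 * η) * (numBases T / 4) := by
    refine max_le (by positivity) ?_
    have h4 : 2 * (numBases T : ℝ) / 8 - 1 ≤ numBases T / 4 := by linarith
    calc _ ≤ 1 / (8 * η * (1 + Real.log T)) * (numBases T / 4) := by gcongr
      _ ≤ _ := by gcongr
  simp only [masterPotential, initState]
  have h5 : 1 / (8 * η) * (numBases T / 4) + 1 / (8 * η) ≤ numBases T / η := by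
    rw [div_mul_eq_mul_div, ← add_div, div_le_div_iff₀ (by positivity) hη]
    nlinarith
  have h6 : (numBases T : ℝ) * (Real.log T + 2) / η =
    numBases T * (Real.log T + 1) / η + numBases T / η := by ring
  linarith

lemma sum_le_of_potential {a : Fin T → ℝ} {Φ : ℕ → ℝ} {c : ℝ}
    (h : ∀ t : Fin T, a t ≤ Φ t - Φ (t + 1) + c) : ∑ t, a t ≤ Φ 0 - Φ T + T * c := by
  refine (Finset.sum_le_sum fun t _ => h t).trans (le_of_eq ?_)
  rw [Finset.sum_add_distrib, Fin.sum_univ_eq_sum_range (fun t => Φ t - Φ (t + 1)),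
    Finset.sum_range_sub']
  simp

/-- The regret of the master on the estimated losses, for every outcome of the draws. The negative
term, linear in `ρ_T(h)`, is what the increasing learning rates buy. -/
lemma master_regret (hT : 2 ≤ T) (hK : 1 ≤ K) {η : ℝ} (hη : 0 < η) {l : Fin T → Fin K → ℝ}
    (hl : ∀ t a, l t a ∈ Set.Icc (0 : ℝ) 1) (ω : History T K) (h : Base T) :
    ∑ t : Fin T, ∑ i, ((stateAt η l ω t).p i - clippedVertex T h i) *
        baseLossEst (stateAt η l ω t) (ω t).1 (l t (ω t).2) i ≤
      numBases T * (Real.log T + 2) / η + 8 * η * T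
        - rhoT η l h ω / (64 * η * (1 + Real.log T)) := by
  have hinv := invariant_stateAt hT hK hη l ω
  have hlog := half_le_log hT
  have h1 := sum_le_of_potential (c := 8 * η)
    (a := fun t : Fin T => ∑ i, ((stateAt η l ω t).p i - clippedVertex T h i) *
        baseLossEst (stateAt η l ω t) (ω t).1 (l t (ω t).2) i)
    (Φ := fun t => masterPotential η (clippedVertex T h) h (stateAt η l ω t)) fun t => by
      simp only [stateAt_succ]
      exact master_step hT hη (hinv t) (clippedVertex_mem hT h)
        (half_le_clippedVertex_self hT h) _ _ (hl _ _)
  have h2 := masterPotential_init (K := K) hT hη h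
  have h3 : 1 / (8 * η * (1 + Real.log T)) * (rhoT η l h ω / 8 - 1) ≤
      masterPotential η (clippedVertex T h) h (stateAt η l ω T) := by
    have h4 : rhoT η l h ω ≤ (stateAt η l ω T).rho h :=
      rho_stateAt_mono hT hK hη l ω h (Nat.sub_le T 1)
    have h5 : 0 ≤ ∑ i, isDiv (clippedVertex T h i) ((stateAt η l ω T).p i) /
        (stateAt η l ω T).xi i := by
      refine Finset.sum_nonneg fun i _ => div_nonneg (isDiv_nonneg ?_ ?_) ?_
      · exact (clip_pos hT (numBases_ge_one T)).trans_le ((clippedVertex_mem hT h).2 i).1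
      · exact (hinv T).p_pos hT i
      · exact hη.le.trans ((hinv T).le_xi i)
    rw [masterPotential]
    refine le_trans ?_ (le_add_of_nonneg_left h5)
    refine le_trans ?_ (le_max_right _ _)
    gcongr
  have h6 : 1 / (8 * η * (1 + Real.log T)) * (rhoT η l h ω / 8 - 1) =
      rhoT η l h ω / (64 * η * (1 + Real.log T)) - 1 / (8 * η * (1 + Real.log T)) := by
    field_simp
    ring
  have h7 : stateAt η l ω 0 = initState T K η := rfl
  simp only [h7] at h1
  linarith

/-! ### The regret of a base -/

lemma cand_pos (hT : 2 ≤ T) (h : Base T) : 0 < cand T h :=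
  Real.rpow_pos_of_pos (by exact_mod_cast (by omega : 0 < T)) _

lemma baseRate_pos (hT : 2 ≤ T) (hK : 1 ≤ K) {η : ℝ} {s : State T K} (hs : s.Invariant η)
    (h : Base T) : 0 < baseRate s h := by
  have h1 := cand_pos hT h
  have h2 := hs.rho_pos h
  have h3 : (0 : ℝ) < T := by exact_mod_cast (by omega : 0 < T)
  have h4 : (0 : ℝ) < K := by exact_mod_cast hK
  exact Real.sqrt_pos.2 (by positivity)

lemma armLossEst_nonneg (hT : 2 ≤ T) (hK : 1 ≤ K) {η : ℝ} {s : State T K} (hs : s.Invariant η)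
    (h₀ : Base T) (a₀ : Fin K) {x : ℝ} (hx : 0 ≤ x) (h : Base T) (a : Fin K) :
    0 ≤ armLossEst s h₀ a₀ x h a := by
  have h1 := hs.p_pos hT h
  have h2 := hs.q_pos hT hK h a
  simp only [armLossEst, baseLossEst]
  split_ifs <;> positivity

lemma sum_klDiv_le {ι : Type*} [Fintype ι] {c : ℝ} (hc : 0 < c) {u q : ι → ℝ}
    (hu : u ∈ clippedSimplex ι c) (hq : q ∈ clippedSimplex ι c) :
    ∑ i, klDiv (u i) (q i) ≤ Real.log (1 / c) := by
  have h1 : ∑ i, klDiv (u i) (q i) = ∑ i, u i * Real.log (u i / q i) := by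
    simp [klDiv, Finset.sum_add_distrib, Finset.sum_sub_distrib, hu.1, hq.1]
  rw [h1]
  calc _ ≤ ∑ i, u i * Real.log (1 / c) := by
        refine Finset.sum_le_sum fun i _ => ?_
        have hui := hc.trans_le (hu.2 i).1
        have hqi := hc.trans_le (hq.2 i).1
        have hle : u i / q i ≤ 1 / c := div_le_div₀ zero_le_one (hu.2 i).2 hc (hq.2 i).1
        gcongr
    _ = _ := by rw [← Finset.sum_mul, hu.1, one_mul]

/-- Telescoping with nondecreasing weights `r`: `k t` and `k' t` are the divergences of the
comparator of round `t` from the distributions before and after this round, and these telescope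
except where the comparator switches. -/
lemma sum_telescope_switch {k k' r : ℕ → ℝ} {L : ℝ} {sw : ℕ → ℕ} (hk : ∀ t, k t ≤ L)
    (hk0 : ∀ t, 0 ≤ k t) (hk' : ∀ t, 0 ≤ k' t) (hr : Monotone r) (hr0 : ∀ t, 0 ≤ r t)
    (hsw : ∀ t, sw t = 0 → k (t + 1) = k' t) (n : ℕ) :
    ∑ t ∈ Finset.range (n + 1), (k t - k' t) * r t ≤
      L * r n * (1 + (∑ t ∈ Finset.range n, sw t : ℕ)) := by
  have hL : 0 ≤ L := (hk0 0).trans (hk 0)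
  have key : ∀ n, ∑ t ∈ Finset.range n, (k t - k' t) * r t ≤
      L * r n * (∑ t ∈ Finset.range n, sw t : ℕ) + (L - k n) * r n := by
    intro n
    induction n with
    | zero => simpa using mul_nonneg (sub_nonneg.2 (hk 0)) (hr0 0)
    | succ n ih =>
      rw [Finset.sum_range_succ, Finset.sum_range_succ (fun t => sw t)]
      have hrn := hr (Nat.le_succ n)
      have h1 : L * r n * (∑ t ∈ Finset.range n, sw t : ℕ) ≤
          L * r (n + 1) * (∑ t ∈ Finset.range n, sw t : ℕ) := by gcongr
      have hk1 := hk (n + 1)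
      push_cast at h1 ih ⊢
      by_cases h0 : sw n = 0
      · have h2 : (L - k (n + 1)) * r n ≤ (L - k (n + 1)) * r (n + 1) := by
          have : 0 ≤ L - k (n + 1) := by linarith
          gcongr
        have h3 := hsw n h0
        rw [h3] at h2 ⊢
        simp only [h0, Nat.cast_zero, add_zero]
        linarith
      · have h2 : L * r n ≤ L * r (n + 1) * sw n := by
          have h4 : (1 : ℝ) ≤ sw n := by exact_mod_cast Nat.one_le_iff_ne_zero.2 h0
          have h5 : L * r n ≤ L * r (n + 1) := by gcongr
          have h6 : 0 ≤ L * r (n + 1) := mul_nonneg hL (hr0 _)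
          nlinarith
        have h3 : 0 ≤ (L - k (n + 1)) * r (n + 1) := mul_nonneg (by linarith) (hr0 _)
        have h4 : 0 ≤ k' n * r n := mul_nonneg (hk' n) (hr0 n)
        linarith
  rw [Finset.sum_range_succ]
  have h1 := key n
  have h2 : 0 ≤ k' n * r n := mul_nonneg (hk' n) (hr0 n)
  linarith

lemma baseRate_inv_mono (hT : 2 ≤ T) (hK : 1 ≤ K) {η : ℝ} (hη : 0 < η)
    (l : Fin T → Fin K → ℝ) (ω : History T K) (h : Base T) :
    Monotone fun t => 1 / baseRate (stateAt η l ω t) h := by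
  intro t t' htt
  have h1 := cand_pos hT h
  have h2 := (invariant_stateAt hT hK hη l ω t).rho_pos h
  have h3 : (0 : ℝ) < T := by exact_mod_cast (by omega : 0 < T)
  have h4 : (0 : ℝ) < K := by exact_mod_cast hK
  have h5 := baseRate_pos hT hK (invariant_stateAt hT hK hη l ω t') h
  have h6 := rho_stateAt_mono hT hK hη l ω h htt
  simp only at h6 ⊢
  gcongr
  simp only [baseRate]
  gcongr

/-- The switching regret of base `h` on its estimated losses, for every outcome of the draws. -/
lemma base_regret (hT : 2 ≤ T) (hK : 1 ≤ K) {η : ℝ} (hη : 0 < η) {l : Fin T → Fin K → ℝ}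
    (hl : ∀ t a, l t a ∈ Set.Icc (0 : ℝ) 1) (ω : History T K) (h : Base T) {S : ℕ}
    {σ : Fin T → Fin K} (hσ : σ ∈ switchSeqs T K S) :
    ∑ t : Fin T, ∑ a, ((stateAt η l ω t).q h a - clippedVertex T (σ t) a) *
        armLossEst (stateAt η l ω t) (ω t).1 (ω t).2 (l t (ω t).2) h a ≤
      Real.log (T * K) * (1 / baseRate (stateAt η l ω (T - 1)) h) * (1 + S) +
      ∑ t : Fin T, baseRate (stateAt η l ω t) h * ∑ a, (stateAt η l ω t).q h a *
        armLossEst (stateAt η l ω t) (ω t).1 (ω t).2 (l t (ω t).2) h a ^ 2 := by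
  have hinv := invariant_stateAt hT hK hη l ω
  have hc : (0 : ℝ) < 1 / ((T : ℝ) * K) := clip_pos hT (by exact_mod_cast hK)
  -- the comparators, continued beyond the last round
  set τ : ℕ → Fin K := fun t => σ ⟨min t (T - 1), by omega⟩ with hτ
  have hτσ : ∀ t : Fin T, τ t = σ t := by
    intro t
    simp only [hτ]
    congr 1
    exact Fin.ext (min_eq_left (by omega))
  set k : ℕ → ℝ := fun t => ∑ a, klDiv (clippedVertex T (τ t) a) ((stateAt η l ω t).q h a)
  set k' : ℕ → ℝ := fun t => ∑ a, klDiv (clippedVertex T (τ t) a) ((stateAt η l ω (t + 1)).q h a)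
  set r : ℕ → ℝ := fun t => 1 / baseRate (stateAt η l ω t) h with hr
  set sw : ℕ → ℕ := fun t => if τ t ≠ τ (t + 1) then 1 else 0 with hsw
  have hpos : ∀ i a, 0 < clippedVertex T (i : Fin K) a := fun i a =>
    hc.trans_le ((clippedVertex_mem hT i).2 a).1
  have htel := sum_telescope_switch (k := k) (k' := k') (r := r) (sw := sw)
    (L := Real.log (T * K))
    (fun t => by
      have := sum_klDiv_le hc (clippedVertex_mem hT (τ t)) ((hinv t).q_mem h)
      rwa [one_div_one_div] at this)
    (fun t => Finset.sum_nonneg fun a _ => klDiv_nonneg (hpos _ _) ((hinv t).q_pos hT hK h a))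
    (fun t => Finset.sum_nonneg fun a _ =>
      klDiv_nonneg (hpos _ _) ((hinv (t + 1)).q_pos hT hK h a))
    (baseRate_inv_mono hT hK hη l ω h)
    (fun t => by have := baseRate_pos hT hK (hinv t) h; positivity)
    (fun t ht => by
      have : τ t = τ (t + 1) := by
        by_contra hne
        simp [hsw, hne] at ht
      simp only [k, k', this]) (T - 1)
  have hS : ∑ t ∈ Finset.range (T - 1), sw t ≤ S := by
    rw [← Fin.sum_univ_eq_sum_range]
    refine le_trans (le_of_eq ?_) hσ
    refine Finset.sum_congr rfl fun t _ => ?_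
    have e1 := hτσ ⟨t, by omega⟩
    have e2 := hτσ ⟨t + 1, by omega⟩
    simp only at e1 e2
    simp only [hsw, e1, e2]
  rw [show T - 1 + 1 = T by omega,
    ← Fin.sum_univ_eq_sum_range (fun t => (k t - k' t) * r t)] at htel
  have hlog : 0 ≤ Real.log (T * K) := Real.log_nonneg (by exact_mod_cast Nat.mul_pos (by omega) hK)
  have hlast : Real.log (T * K) * r (T - 1) * (1 + (∑ t ∈ Finset.range (T - 1), sw t : ℕ)) ≤
      Real.log (T * K) * r (T - 1) * (1 + S) := by
    have : 0 ≤ r (T - 1) := by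
      have := baseRate_pos hT hK (hinv (T - 1)) h
      simp only [hr]; positivity
    gcongr
  refine le_trans ?_ (add_le_add_left (htel.trans hlast) _)
  rw [← Finset.sum_add_distrib]
  refine Finset.sum_le_sum fun t _ => ?_
  have := omdStep_negEntropy_regret hc ((hinv t).q_mem h) (baseRate_pos hT hK (hinv t) h)
    (fun a => armLossEst_nonneg hT hK (hinv t) (ω t).1 (ω t).2 (hl t (ω t).2).1 h a)
    (clippedVertex_mem hT (σ t))
  simp only [k, k', r, stateAt_succ, hτσ]
  exact this

/-! ### Taking expectations -/

lemma drawProb_nonneg (hT : 2 ≤ T) (hK : 1 ≤ K) {η : ℝ} {s : State T K} (hs : s.Invariant η)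
    (z : Base T × Fin K) : 0 ≤ drawProb s z :=
  mul_nonneg (hs.p_pos hT _).le (hs.q_pos hT hK _ _).le

lemma sum_drawProb {η : ℝ} {s : State T K} (hs : s.Invariant η) :
    ∑ z, drawProb s z = 1 := by
  simp [drawProb, Fintype.sum_prod_type, ← Finset.mul_sum, (hs.q_mem _).1, hs.p_mem.1]

lemma sum_drawProb_baseLossEst (hT : 2 ≤ T) {η : ℝ} {s : State T K}
    (hs : s.Invariant η) (f : Fin K → ℝ) (h : Base T) :
    ∑ z, drawProb s z * baseLossEst s z.1 (f z.2) h = ∑ a, s.q h a * f a := by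
  have hp := (hs.p_pos hT h).ne'
  rw [Fintype.sum_prod_type, Finset.sum_eq_single h (fun i _ hi => by
    simp [baseLossEst, hi.symm]) (by simp)]
  refine Finset.sum_congr rfl fun a _ => ?_
  simp only [drawProb, baseLossEst, if_true]
  field_simp

/-- The loss estimators of a base are unbiased. -/
lemma sum_drawProb_armLossEst (hT : 2 ≤ T) (hK : 1 ≤ K) {η : ℝ} {s : State T K}
    (hs : s.Invariant η) (f : Fin K → ℝ) (h : Base T) (a : Fin K) :
    ∑ z, drawProb s z * armLossEst s z.1 z.2 (f z.2) h a = f a := by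
  have hp := (hs.p_pos hT h).ne'
  have hq := (hs.q_pos hT hK h a).ne'
  rw [Fintype.sum_prod_type, Finset.sum_eq_single h (fun i _ hi => by
    simp [baseLossEst, armLossEst, hi.symm]) (by simp),
    Finset.sum_eq_single a (fun b _ hb => by simp [armLossEst, hb.symm]) (by simp)]
  simp only [drawProb, baseLossEst, armLossEst, if_true]
  field_simp

/-- The expected local norm of the loss estimator of a base: the variance `K / p_t(h)` is at most
`K ρ_t(h)`. -/
lemma sum_drawProb_armLossEst_sq (hT : 2 ≤ T) (hK : 1 ≤ K) {η : ℝ} {s : State T K}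
    (hs : s.Invariant η) {f : Fin K → ℝ} (hf : ∀ a, f a ∈ Set.Icc (0 : ℝ) 1) (h : Base T) :
    ∑ z, drawProb s z * ∑ a, s.q h a * armLossEst s z.1 z.2 (f z.2) h a ^ 2 ≤ K * s.rho h := by
  have hp := hs.p_pos hT h
  simp only [Finset.mul_sum]
  rw [Finset.sum_comm]
  have h1 : ∀ a, ∑ z, drawProb s z * (s.q h a * armLossEst s z.1 z.2 (f z.2) h a ^ 2) ≤
      s.rho h := by
    intro a
    have hq := hs.q_pos hT hK h a
    rw [Fintype.sum_prod_type, Finset.sum_eq_single h (fun i _ hi => by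
      simp [baseLossEst, armLossEst, hi.symm]) (by simp),
      Finset.sum_eq_single a (fun b _ hb => by simp [armLossEst, hb.symm]) (by simp)]
    simp only [drawProb, baseLossEst, armLossEst, if_true]
    have h2 : s.p h * s.q h a * (s.q h a * (f a / s.p h / s.q h a) ^ 2) =
        f a ^ 2 * (1 / s.p h) := by
      field_simp
    rw [h2]
    refine le_trans ?_ (hs.inv_p_le h)
    exact mul_le_of_le_one_left (by positivity) (pow_le_one₀ (hf a).1 (hf a).2)
  refine (Finset.sum_le_sum fun a _ => h1 a).trans (le_of_eq ?_)
  simp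

/-- The regret of one round splits, in conditional expectation, into that of the master against
base `h` and that of base `h` against arm `b`; clipping the comparators costs `2 / T`. -/
lemma round_regret (hT : 2 ≤ T) (hK : 1 ≤ K) {η : ℝ} {s : State T K}
    (hs : s.Invariant η) {f : Fin K → ℝ} (hf : ∀ a, f a ∈ Set.Icc (0 : ℝ) 1) (h : Base T)
    (b : Fin K) :
    ∑ z, drawProb s z * f z.2 - f b ≤
      ∑ z, drawProb s z * (∑ i, (s.p i - clippedVertex T h i) * baseLossEst s z.1 (f z.2) i +
        ∑ a, (s.q h a - clippedVertex T b a) * armLossEst s z.1 z.2 (f z.2) h a) + 2 / T := by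
  have hH := numBases_ge_one T
  have hK1 : (1 : ℝ) ≤ K := by exact_mod_cast hK
  have hT2 : (2 : ℝ) ≤ T := by exact_mod_cast hT
  have hT1 : 1 / (T : ℝ) ≤ 1 := by rw [div_le_one (by positivity)]; linarith
  have hpt : ∀ z : Base T × Fin K,
      f z.2 - 1 / ((T : ℝ) * numBases T) * ∑ i, baseLossEst s z.1 (f z.2) i
        - ∑ a, clippedVertex T b a * armLossEst s z.1 z.2 (f z.2) h a ≤
      ∑ i, (s.p i - clippedVertex T h i) * baseLossEst s z.1 (f z.2) i +
        ∑ a, (s.q h a - clippedVertex T b a) * armLossEst s z.1 z.2 (f z.2) h a := by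
    rintro ⟨h₀, a₀⟩
    simp only
    have e1 : ∑ i, s.p i * baseLossEst s h₀ (f a₀) i = f a₀ := by
      have := (hs.p_pos hT h₀).ne'
      rw [Finset.sum_eq_single h₀ (fun i _ hi => by simp [baseLossEst, hi]) (by simp)]
      simp only [baseLossEst, if_true]
      field_simp
    have e2 : ∑ a, s.q h a * armLossEst s h₀ a₀ (f a₀) h a = baseLossEst s h₀ (f a₀) h := by
      have := (hs.q_pos hT hK h a₀).ne'
      rw [Finset.sum_eq_single a₀ (fun i _ hi => by simp [armLossEst, hi]) (by simp)]
      simp only [armLossEst, if_true]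
      field_simp
    have e3 : ∑ i, clippedVertex T h i * baseLossEst s h₀ (f a₀) i =
        (1 - 1 / (T : ℝ)) * baseLossEst s h₀ (f a₀) h +
          1 / ((T : ℝ) * numBases T) * ∑ i, baseLossEst s h₀ (f a₀) i := by
      simp only [clippedVertex, add_mul, Finset.sum_add_distrib, ite_mul, zero_mul,
        Finset.sum_ite_eq', Finset.mem_univ, if_true, Finset.mul_sum]
    have h0 : 0 ≤ baseLossEst s h₀ (f a₀) h := by
      have := hs.p_pos hT h
      have := (hf a₀).1
      simp only [baseLossEst]
      split_ifs <;> positivity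
    have h1 : 0 ≤ 1 / (T : ℝ) * baseLossEst s h₀ (f a₀) h := by positivity
    simp only [sub_mul, Finset.sum_sub_distrib, e1, e2, e3]
    linarith
  have hsum := Finset.sum_le_sum fun z (_ : z ∈ Finset.univ) =>
    mul_le_mul_of_nonneg_left (hpt z) (drawProb_nonneg hT hK hs z)
  refine le_trans ?_ (add_le_add_left hsum _)
  simp only [mul_sub, Finset.sum_sub_distrib]
  have e4 : ∑ z, drawProb s z * (1 / ((T : ℝ) * numBases T) * ∑ i, baseLossEst s z.1 (f z.2) i) ≤
      1 / T := by
    have : ∑ z, drawProb s z * (1 / ((T : ℝ) * numBases T) *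
        ∑ i, baseLossEst s z.1 (f z.2) i) = 1 / ((T : ℝ) * numBases T) *
        ∑ i, ∑ z, drawProb s z * baseLossEst s z.1 (f z.2) i := by
      rw [Finset.sum_comm, Finset.mul_sum]
      refine Finset.sum_congr rfl fun z _ => ?_
      rw [← Finset.mul_sum]
      ring
    rw [this]
    have h2 : ∑ i : Base T, ∑ z, drawProb s z * baseLossEst s z.1 (f z.2) i ≤ numBases T := by
      have h3 : ∀ i : Base T, ∑ z, drawProb s z * baseLossEst s z.1 (f z.2) i ≤ 1 := by
        intro i
        rw [sum_drawProb_baseLossEst hT hs, ← (hs.q_mem i).1]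
        exact Finset.sum_le_sum fun a _ =>
          mul_le_of_le_one_right (hs.q_pos hT hK i a).le (hf a).2
      refine (Finset.sum_le_sum fun i _ => h3 i).trans (le_of_eq ?_)
      simp
    calc _ ≤ 1 / ((T : ℝ) * numBases T) * numBases T := by gcongr
      _ = 1 / T := by field_simp
  have e5 : ∑ z, drawProb s z * ∑ a, clippedVertex T b a * armLossEst s z.1 z.2 (f z.2) h a ≤
      f b + 1 / T := by
    have : ∑ z, drawProb s z * ∑ a, clippedVertex T b a * armLossEst s z.1 z.2 (f z.2) h a =
        ∑ a, clippedVertex T b a * f a := by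
      simp only [Finset.mul_sum]
      rw [Finset.sum_comm]
      refine Finset.sum_congr rfl fun a _ => ?_
      rw [← sum_drawProb_armLossEst hT hK hs f h a, Finset.mul_sum]
      exact Finset.sum_congr rfl fun z _ => by ring
    rw [this]
    simp only [clippedVertex, add_mul, Finset.sum_add_distrib, ite_mul, zero_mul,
        Finset.sum_ite_eq', Finset.mem_univ, if_true, ← Finset.mul_sum]
    have h2 : ∑ a, f a ≤ K := by
      refine (Finset.sum_le_sum fun a _ => (hf a).2).trans (le_of_eq ?_)
      simp
    have h3 : 1 / ((T : ℝ) * K) * ∑ a, f a ≤ 1 / ((T : ℝ) * K) * K := by gcongr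
    have h4 : 1 / ((T : ℝ) * K) * K = 1 / T := by field_simp
    have h5 : 0 ≤ 1 / (T : ℝ) * f b := mul_nonneg (by positivity) (hf b).1
    linarith
  have e6 : (2 : ℝ) / T = 1 / T + 1 / T := by ring
  linarith

lemma baseRate_mul_le (hT : 2 ≤ T) (hK : 1 ≤ K) {η : ℝ} {s : State T K} (hs : s.Invariant η)
    (h : Base T) :
    baseRate s h * (K * s.rho h) = √(cand T h * K * T * s.rho h) / T := by
  have h1 := cand_pos hT h
  have h2 := hs.rho_pos h
  have h3 : (0 : ℝ) < T := by exact_mod_cast (by omega : 0 < T)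
  have h4 : (0 : ℝ) < K := by exact_mod_cast hK
  have e1 : (K : ℝ) * s.rho h = √((K * s.rho h) ^ 2) := (Real.sqrt_sq (by positivity)).symm
  have e2 : (T : ℝ) = √((T : ℝ) ^ 2) := (Real.sqrt_sq (by positivity)).symm
  rw [baseRate]
  conv_lhs => rw [e1]
  conv_rhs => rw [e2, ← Real.sqrt_div (by positivity)]
  rw [← Real.sqrt_mul (by positivity), Real.sqrt_sq h3.le]
  congr 1
  field_simp

/-- The regret bound against one sequence of arms before the parameters are chosen. -/
lemma regret_le (hT : 2 ≤ T) (hK : 1 ≤ K) {η : ℝ} (hη : 0 < η) {l : Fin T → Fin K → ℝ}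
    (hl : ∀ t a, l t a ∈ Set.Icc (0 : ℝ) 1) (h : Base T) {S : ℕ}
    {σ : Fin T → Fin K} (hσ : σ ∈ switchSeqs T K S) :
    ∑ t : Fin T, (expect η l (fun ω => l t (ω t).2) - l t (σ t)) ≤
      2 + expect η l (fun ω => numBases T * (Real.log T + 2) / η + 8 * η * T
          - rhoT η l h ω / (64 * η * (1 + Real.log T))
        + (Real.log (T * K) * (1 / baseRate (stateAt η l ω (T - 1)) h) * (1 + S)
        + √(cand T h * K * T * rhoT η l h ω))) := by
  have : NeZero K := ⟨by omega⟩
  have hinv := invariant_stateAt hT hK hη l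
  have hT0 : (0 : ℝ) < T := by exact_mod_cast (by omega : 0 < T)
  have hp1 : ∀ ω t, ∑ z, drawProb (stateAt η l ω t) z = 1 := fun ω t => sum_drawProb (hinv ω t)
  have hp0 : ∀ ω t z, 0 ≤ drawProb (stateAt η l ω t) z :=
    fun ω t z => drawProb_nonneg hT hK (hinv ω t) z
  set M : Fin T → State T K → Base T × Fin K → ℝ := fun t s z =>
    ∑ i, (s.p i - clippedVertex T h i) * baseLossEst s z.1 (l t z.2) i with hM
  set B : Fin T → State T K → Base T × Fin K → ℝ := fun t s z =>
    ∑ a, (s.q h a - clippedVertex T (σ t) a) * armLossEst s z.1 z.2 (l t z.2) h a with hB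
  set V : Fin T → State T K → Base T × Fin K → ℝ := fun t s z =>
    baseRate s h * ∑ a, s.q h a * armLossEst s z.1 z.2 (l t z.2) h a ^ 2 with hV
  have h1 : ∀ t : Fin T, expect η l (fun ω => l t (ω t).2) - l t (σ t) ≤
      expect η l (fun ω => M t (stateAt η l ω t) (ω t) + B t (stateAt η l ω t) (ω t)) + 2 / T := by
    intro t
    rw [expect_draw hp1 t (fun _ z => l t z.2),
      expect_draw hp1 t (fun s z => M t s z + B t s z),
      ← expect_const (η := η) (l := l) hp1 (l t (σ t)),
      ← expect_const (η := η) (l := l) hp1 (2 / T), ← expect_sub, ← expect_add]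
    refine expect_mono hp0 fun ω => ?_
    have := round_regret hT hK (hinv ω t) (hl t) h (σ t)
    exact this
  have h2 : ∀ t : Fin T, expect η l (fun ω => V t (stateAt η l ω t) (ω t)) ≤
      expect η l (fun ω => √(cand T h * K * T * rhoT η l h ω) / T) := by
    intro t
    rw [expect_draw hp1 t (V t)]
    refine expect_mono hp0 fun ω => ?_
    have hr := baseRate_pos hT hK (hinv ω t) h
    calc ∑ z, drawProb (stateAt η l ω t) z * V t (stateAt η l ω t) z
        = baseRate (stateAt η l ω t) h * ∑ z, drawProb (stateAt η l ω t) z *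
          ∑ a, (stateAt η l ω t).q h a *
            armLossEst (stateAt η l ω t) z.1 z.2 (l t z.2) h a ^ 2 := by
          rw [Finset.mul_sum]
          exact Finset.sum_congr rfl fun z _ => by simp only [hV]; ring
      _ ≤ baseRate (stateAt η l ω t) h * (K * (stateAt η l ω t).rho h) := by
          gcongr
          exact sum_drawProb_armLossEst_sq hT hK (hinv ω t) (hl t) h
      _ = √(cand T h * K * T * (stateAt η l ω t).rho h) / T := baseRate_mul_le hT hK (hinv ω t) h
      _ ≤ _ := by
          have hc := (cand_pos hT h).le
          have hρ : (stateAt η l ω t).rho h ≤ rhoT η l h ω :=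
            rho_stateAt_mono hT hK hη l ω h (show (t : ℕ) ≤ T - 1 by omega)
          gcongr
  have h3 : ∑ t : Fin T, expect η l (fun ω => V t (stateAt η l ω t) (ω t)) ≤
      expect η l (fun ω => √(cand T h * K * T * rhoT η l h ω)) := by
    refine (Finset.sum_le_sum fun t _ => h2 t).trans (le_of_eq ?_)
    simp only [div_eq_inv_mul, expect_const_mul]
    simp
    field_simp
  have h4 : expect η l (fun ω => ∑ t, (M t (stateAt η l ω t) (ω t) + B t (stateAt η l ω t) (ω t))) ≤
      expect η l (fun ω => numBases T * (Real.log T + 2) / η + 8 * η * T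
          - rhoT η l h ω / (64 * η * (1 + Real.log T))
        + (Real.log (T * K) * (1 / baseRate (stateAt η l ω (T - 1)) h) * (1 + S)
        + ∑ t, V t (stateAt η l ω t) (ω t))) := by
    refine expect_mono hp0 fun ω => ?_
    rw [Finset.sum_add_distrib]
    exact add_le_add (master_regret hT hK hη hl ω h) (base_regret hT hK hη hl ω h hσ)
  have h5 := Finset.sum_le_sum fun t (_ : t ∈ Finset.univ) => h1 t
  rw [Finset.sum_add_distrib, ← expect_sum] at h5
  have h6 : ∑ _t : Fin T, (2 : ℝ) / T = 2 := by
    simp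
    field_simp
  rw [h6] at h5
  rw [expect_add, expect_add] at h4
  rw [← expect_sum] at h3
  rw [expect_add, expect_add]
  linarith

/-! ### The candidate closest to the number of switches -/

lemma cand_nearOpt (hT : 2 ≤ T) {S : ℕ} (hS : 1 ≤ S) (hST : S ≤ T - 1) :
    cand T (nearOpt T S) ≤ S ∧ (S : ℝ) ≤ 3 * cand T (nearOpt T S) := by
  have hT1 : (1 : ℝ) < T := by exact_mod_cast (by omega : 1 < T)
  have hlog : 0 < Real.log T := Real.log_pos hT1
  have hn : 0 < ⌈Real.log T⌉₊ := Nat.ceil_pos.2 hlog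
  have hn' : (0 : ℝ) < (⌈Real.log T⌉₊ : ℕ) := by exact_mod_cast hn
  set A := Finset.univ.filter fun i : Base T => cand T i ≤ (S : ℝ) with hA
  have hne : A.Nonempty := ⟨0, Finset.mem_filter.2 ⟨Finset.mem_univ _, by simpa [cand] using hS⟩⟩
  have hmem : nearOpt T S ∈ A := by
    have := Finset.exists_mem_eq_sup A hne id
    obtain ⟨i, hi, he⟩ := this
    have : nearOpt T S = i := he
    rwa [this]
  have hle : cand T (nearOpt T S) ≤ S := (Finset.mem_filter.1 hmem).2
  refine ⟨hle, ?_⟩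
  have hST' : (S : ℝ) < T := by exact_mod_cast (by omega : S < T)
  have hlt : (nearOpt T S : ℕ) < ⌈Real.log T⌉₊ := by
    by_contra hcon
    have h1 : (nearOpt T S : ℕ) = ⌈Real.log T⌉₊ := by
      have : (nearOpt T S : ℕ) < ⌈Real.log T⌉₊ + 1 := (nearOpt T S).2
      omega
    have h2 : cand T (nearOpt T S) = T := by
      rw [cand, h1, div_self hn'.ne', Real.rpow_one]
    linarith
  let j : Base T := ⟨nearOpt T S + 1, Nat.succ_lt_succ hlt⟩
  have hj : (S : ℝ) < cand T j := by
    by_contra hcon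
    have h1 : j ∈ A := Finset.mem_filter.2 ⟨Finset.mem_univ _, not_lt.1 hcon⟩
    have h2 : j ≤ nearOpt T S := Finset.le_sup (f := id) h1
    have h3 : (nearOpt T S : ℕ) + 1 ≤ nearOpt T S := h2
    omega
  have hcj : cand T j = cand T (nearOpt T S) * (T : ℝ) ^ (1 / ((⌈Real.log T⌉₊ : ℕ) : ℝ)) := by
    rw [cand, cand, ← Real.rpow_add (by linarith), ← add_div]
    simp [j]
  have h3 : (T : ℝ) ^ (1 / ((⌈Real.log T⌉₊ : ℕ) : ℝ)) ≤ 3 := by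
    rw [Real.rpow_def_of_pos (by linarith)]
    have h4 : Real.log T * (1 / ((⌈Real.log T⌉₊ : ℕ) : ℝ)) ≤ 1 := by
      rw [mul_one_div, div_le_one hn']
      exact Nat.le_ceil _
    have := Real.exp_one_lt_d9
    linarith [Real.exp_le_exp.2 h4]
  have h5 := mul_le_mul_of_nonneg_left h3 (cand_pos hT (nearOpt T S)).le
  linarith

/-! ### Choosing the parameters -/

lemma switchRegret_le {S : ℕ} {η : ℝ} {l : Fin T → Fin K → ℝ} {c : ℝ} (hc : 0 ≤ c)
    (h : ∀ σ ∈ switchSeqs T K S,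
      ∑ t : Fin T, (expect η l (fun ω => l t (ω t).2) - l t (σ t)) ≤ c) :
    switchRegret S η l ≤ c := by
  refine Real.sSup_le ?_ hc
  rintro _ ⟨σ, hσ, rfl⟩
  exact h σ hσ

lemma numBases_le (hT : 2 ≤ T) : (numBases T : ℝ) ≤ Real.log T + 2 := by
  have h1 := Nat.ceil_lt_add_one (show 0 ≤ Real.log T by linarith [half_le_log hT])
  rw [numBases]
  push_cast
  linarith

lemma inv_baseRate_nearOpt_le (hT : 2 ≤ T) (hK : 1 ≤ K) {S : ℕ} (hS : 1 ≤ S) (hST : S ≤ T - 1)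
    {η : ℝ} {s : State T K} (hs : s.Invariant η) :
    1 / baseRate s (nearOpt T S) * (1 + S) ≤
      4 * √((S : ℝ) * K * T * s.rho (nearOpt T S)) := by
  have h1 := cand_pos hT (nearOpt T S)
  have h2 := hs.rho_pos (nearOpt T S)
  have h3 : (0 : ℝ) < T := by exact_mod_cast (by omega : 0 < T)
  have h4 : (0 : ℝ) < K := by exact_mod_cast hK
  have h5 : (1 : ℝ) ≤ S := by exact_mod_cast hS
  have h6 := (cand_nearOpt hT hS hST).2
  rw [one_div_mul_eq_div, div_le_iff₀ (baseRate_pos hT hK hs _), baseRate, mul_assoc,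
    ← Real.sqrt_mul (by positivity)]
  have h7 : (S : ℝ) / 2 ≤ √((S : ℝ) * K * T * s.rho (nearOpt T S) *
      (cand T (nearOpt T S) / (K * T * s.rho (nearOpt T S)))) := by
    refine Real.le_sqrt_of_sq_le ?_
    have : (S : ℝ) * K * T * s.rho (nearOpt T S) *
      (cand T (nearOpt T S) / (K * T * s.rho (nearOpt T S))) = S * cand T (nearOpt T S) := by
      field_simp
    rw [this]
    nlinarith
  linarith

/-- The regret bound for base `h†`, when there are at most `T` arms. -/
lemma regret_nearOpt_le (hT : 2 ≤ T) (hK : 1 ≤ K) (hKT : K ≤ T) {S : ℕ} (hS : 1 ≤ S)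
    (hST : S ≤ T - 1) {η : ℝ} (hη : 0 < η) {l : Fin T → Fin K → ℝ}
    (hl : ∀ t a, l t a ∈ Set.Icc (0 : ℝ) 1) {Y : History T K → ℝ}
    (hY : ∀ ω, 2 + (numBases T * (Real.log T + 2) / η + 8 * η * T
      - rhoT η l (nearOpt T S) ω / (64 * η * (1 + Real.log T))
      + 10 * Real.log T * √((S : ℝ) * K * T * rhoT η l (nearOpt T S) ω)) ≤ Y ω)
    {σ : Fin T → Fin K} (hσ : σ ∈ switchSeqs T K S) :
    ∑ t : Fin T, (expect η l (fun ω => l t (ω t).2) - l t (σ t)) ≤ expect η l Y := by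
  have : NeZero K := ⟨by omega⟩
  have hinv := invariant_stateAt hT hK hη l
  have hT0 : (0 : ℝ) < T := by exact_mod_cast (by omega : 0 < T)
  have hK0 : (0 : ℝ) < K := by exact_mod_cast hK
  refine (regret_le hT hK hη hl (nearOpt T S) hσ).trans ?_
  refine (add_le_add_left
    (expect_const (η := η) (l := l) (fun ω t => sum_drawProb (hinv ω t)) 2).ge _).trans ?_
  rw [← expect_add]
  refine expect_mono (fun ω t z => drawProb_nonneg hT hK (hinv ω t) z) fun ω =>
    le_trans ?_ (hY ω)
  have h1 := inv_baseRate_nearOpt_le hT hK hS hST (hinv ω (T - 1))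
  set y := √((S : ℝ) * K * T * rhoT η l (nearOpt T S) ω) with hy
  have hy0 : 0 ≤ y := Real.sqrt_nonneg _
  have h2 : √(cand T (nearOpt T S) * K * T * rhoT η l (nearOpt T S) ω) ≤ y := by
    have hρ : 0 < rhoT η l (nearOpt T S) ω := (hinv ω (T - 1)).rho_pos _
    have := (cand_nearOpt hT hS hST).1
    rw [hy]
    gcongr
  have hlog := half_le_log hT
  have h3 : Real.log (T * K) ≤ 2 * Real.log T := by
    rw [Real.log_mul hT0.ne' hK0.ne']
    have := Real.log_le_log hK0 (by exact_mod_cast hKT : (K : ℝ) ≤ T)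
    linarith
  have h4 : Real.log (T * K) * (1 / baseRate (stateAt η l ω (T - 1)) (nearOpt T S)) * (1 + S) ≤
      2 * Real.log T * (4 * y) := by
    rw [mul_assoc]
    have hb := baseRate_pos hT hK (hinv ω (T - 1)) (nearOpt T S)
    exact mul_le_mul h3 h1 (by positivity) (by linarith)
  have h5 : y ≤ 2 * Real.log T * y := le_mul_of_one_le_left hy0 (by linarith)
  linarith

section Bounds

variable {S : ℕ} {η : ℝ} {l : Fin T → Fin K → ℝ}

lemma sqrt_mul_sqrt_le (hT : 2 ≤ T) (hK : 1 ≤ K) (hS : 1 ≤ S) (hη : 0 < η) (ω : History T K)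
    (h : Base T) :
    √(numBases T : ℝ) * √((K : ℝ) * T) ≤ √((S : ℝ) * K * T * rhoT η l h ω) := by
  have hS1 : (1 : ℝ) ≤ S := by exact_mod_cast hS
  have hH := numBases_ge_one T
  have hρ := (invariant_stateAt hT hK hη l ω (T - 1)).le_rho h
  rw [← Real.sqrt_mul (by positivity)]
  refine Real.sqrt_le_sqrt ?_
  have h1 : (numBases T : ℝ) ≤ S * rhoT η l h ω := by
    have : (numBases T : ℝ) ≤ rhoT η l h ω := by
      rw [rhoT]; linarith
    nlinarith
  calc (numBases T : ℝ) * (K * T) ≤ S * rhoT η l h ω * (K * T) := by gcongr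
    _ = _ := by ring

lemma one_le_sqrt_mul (hT : 2 ≤ T) (hK : 1 ≤ K) : 1 ≤ √((K : ℝ) * T) := by
  refine Real.one_le_sqrt.2 ?_
  exact_mod_cast Nat.mul_pos hK (by omega)

lemma pow_four_ge (hT : 2 ≤ T) : 40 * Real.log T ≤ 32000 * Real.log T ^ 4 := by
  have hlog := half_le_log hT
  nlinarith [pow_le_pow_left₀ (by norm_num) hlog 3]

/-- The trivial bound by `T` suffices when there are more arms than rounds. -/
lemma regret_le_of_le (hT : 2 ≤ T) (hK : 1 ≤ K) (hη : 0 < η)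
    (hl : ∀ t a, l t a ∈ Set.Icc (0 : ℝ) 1) (σ : Fin T → Fin K) :
    ∑ t : Fin T, (expect η l (fun ω => l t (ω t).2) - l t (σ t)) ≤ T := by
  have : NeZero K := ⟨by omega⟩
  have hinv := invariant_stateAt hT hK hη l
  have h1 : ∀ t : Fin T, expect η l (fun ω => l t (ω t).2) - l t (σ t) ≤ 1 := by
    intro t
    have h2 : expect η l (fun ω => l t (ω t).2) ≤ 1 := by
      rw [← expect_const (η := η) (l := l) (fun ω t => sum_drawProb (hinv ω t)) 1]
      exact expect_mono (fun ω t z => drawProb_nonneg hT hK (hinv ω t) z) fun ω => (hl _ _).2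
    linarith [(hl t (σ t)).1]
  refine (Finset.sum_le_sum fun t _ => h1 t).trans (le_of_eq ?_)
  simp

/-- The bound in terms of `ρ_T(h†)`, for any initial rate `η` that balances the two terms of the
regret of the master up to constants. -/
lemma switchRegret_le_expect (hT : 2 ≤ T) (hK : 1 ≤ K) (hS : 1 ≤ S) (hST : S ≤ T - 1)
    (hη : 0 < η) (hη1 : numBases T / η ≤ √(numBases T : ℝ) * √((K : ℝ) * T))
    (hη2 : η * T ≤ √(numBases T : ℝ) * √((K : ℝ) * T))
    (hl : ∀ t a, l t a ∈ Set.Icc (0 : ℝ) 1) :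
    switchRegret S η l ≤ 32000 * Real.log T ^ 4 *
      expect η l (fun ω => √((S : ℝ) * K * T * rhoT η l (nearOpt T S) ω)) := by
  have : NeZero K := ⟨by omega⟩
  have hinv := invariant_stateAt hT hK hη l
  have hp0 : ∀ ω t z, 0 ≤ drawProb (stateAt η l ω t) z :=
    fun ω t z => drawProb_nonneg hT hK (hinv ω t) z
  have hp1 : ∀ ω t, ∑ z, drawProb (stateAt η l ω t) z = 1 := fun ω t => sum_drawProb (hinv ω t)
  have hlog := half_le_log hT
  have hA := one_le_sqrt_mul hT hK
  have hg : 1 ≤ √(numBases T : ℝ) := Real.one_le_sqrt.2 (numBases_ge_one T)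
  have hC := pow_four_ge hT
  have hlow := sqrt_mul_sqrt_le (l := l) hT hK hS hη
  have hgA : √((K : ℝ) * T) ≤ √(numBases T : ℝ) * √((K : ℝ) * T) :=
    le_mul_of_one_le_left (by linarith) hg
  rw [← expect_const_mul]
  have hC1 : 1 ≤ 32000 * Real.log T ^ 4 := by linarith
  refine switchRegret_le ?_ fun σ hσ => ?_
  · rw [← expect_const (η := η) (l := l) hp1 0]
    exact expect_mono hp0 fun ω => by positivity
  rcases le_total K T with hKT | hKT
  · refine regret_nearOpt_le hT hK hKT hS hST hη hl (fun ω => ?_) hσ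
    have h1 := hlow ω (nearOpt T S)
    set y := √((S : ℝ) * K * T * rhoT η l (nearOpt T S) ω)
    have hy1 : 1 ≤ y := by linarith
    have h2 : 0 ≤ rhoT η l (nearOpt T S) ω / (64 * η * (1 + Real.log T)) := by
      have : 0 < rhoT η l (nearOpt T S) ω := (hinv ω (T - 1)).rho_pos _
      positivity
    have h3 : numBases T * (Real.log T + 2) / η ≤ 5 * Real.log T * y := by
      calc (numBases T : ℝ) * (Real.log T + 2) / η = (Real.log T + 2) * (numBases T / η) := by ring
        _ ≤ (5 * Real.log T) * y := by
          have : numBases T / η ≤ y := hη1.trans h1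
          gcongr
          linarith
    have h4 : 40 * Real.log T * y ≤ 32000 * Real.log T ^ 4 * y := by gcongr
    have h5 : 1 / 2 * y ≤ Real.log T * y := by gcongr
    linarith
  · refine (regret_le_of_le hT hK hη hl σ).trans ?_
    refine (expect_const (η := η) (l := l) hp1 T).ge.trans (expect_mono hp0 fun ω => ?_)
    have h1 : (T : ℝ) ≤ √((K : ℝ) * T) := by
      refine Real.le_sqrt_of_sq_le ?_
      rw [sq]
      have : (T : ℝ) ≤ K := by exact_mod_cast hKT
      gcongr
    have h2 := hlow ω (nearOpt T S)
    calc (T : ℝ) ≤ √((S : ℝ) * K * T * rhoT η l (nearOpt T S) ω) := by linarith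
      _ ≤ _ := le_mul_of_one_le_left (Real.sqrt_nonneg _) hC1

/-- The bound by `S √(KT)`: with the smaller rate, the negative term in the regret of the master
absorbs the dependence of the regret of the base on `ρ_T(h†)`. -/
lemma switchRegret_le_sqrt (hT : 2 ≤ T) (hK : 1 ≤ K) (hS : 1 ≤ S) (hST : S ≤ T - 1)
    (hη : 0 < η) (hη1 : η = √(numBases T : ℝ) / √((K : ℝ) * T))
    (hη2 : η * T ≤ √(numBases T : ℝ) * √((K : ℝ) * T))
    (hl : ∀ t a, l t a ∈ Set.Icc (0 : ℝ) 1) :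
    switchRegret S η l ≤ 32000 * Real.log T ^ 4 * (S * √((K : ℝ) * T)) := by
  have : NeZero K := ⟨by omega⟩
  have hinv := invariant_stateAt hT hK hη l
  have hp1 : ∀ ω t, ∑ z, drawProb (stateAt η l ω t) z = 1 := fun ω t => sum_drawProb (hinv ω t)
  have hlog := half_le_log hT
  have hA := one_le_sqrt_mul hT hK
  have hH := numBases_ge_one T
  have hHle := numBases_le hT
  have hC := pow_four_ge hT
  have hS1 : (1 : ℝ) ≤ S := by exact_mod_cast hS
  have hC1 : 1 ≤ 32000 * Real.log T ^ 4 := by linarith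
  refine switchRegret_le (by positivity) fun σ hσ => ?_
  rcases le_total K T with hKT | hKT
  · rw [← expect_const (η := η) (l := l) hp1 (32000 * Real.log T ^ 4 * (S * √((K : ℝ) * T)))]
    refine regret_nearOpt_le hT hK hKT hS hST hη hl (fun ω => ?_) hσ
    have hρ : 0 < rhoT η l (nearOpt T S) ω := (hinv ω (T - 1)).rho_pos _
    have e1 : √((S : ℝ) * K * T * rhoT η l (nearOpt T S) ω) =
        √((K : ℝ) * T) * (√(S : ℝ) * √(rhoT η l (nearOpt T S) ω)) := by
      rw [← Real.sqrt_mul (by positivity), ← Real.sqrt_mul (by positivity)]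
      congr 1
      ring
    have hx2 : √(rhoT η l (nearOpt T S) ω) ^ 2 = rhoT η l (nearOpt T S) ω := Real.sq_sqrt hρ.le
    have hs2 : √(S : ℝ) ^ 2 = S := Real.sq_sqrt (by linarith)
    have hg2 : √(numBases T : ℝ) ^ 2 = numBases T := Real.sq_sqrt (by linarith)
    have hg : 1 ≤ √(numBases T : ℝ) := Real.one_le_sqrt.2 hH
    rw [e1]
    set A := √((K : ℝ) * T)
    set s := √(S : ℝ)
    set x := √(rhoT η l (nearOpt T S) ω)
    set g := √(numBases T : ℝ)
    set L := Real.log T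
    rw [← hx2, ← hs2]
    have hA0 : 0 < A := by linarith
    have hg0 : 0 < g := by linarith
    have hgle : g ≤ 5 * L := by nlinarith
    have e2 : numBases T * (L + 2) / η = g * (L + 2) * A := by
      rw [hη1, ← hg2]; field_simp
    have e3 : x ^ 2 / (64 * η * (1 + L)) = A * (x ^ 2 / (64 * g * (1 + L))) := by
      rw [hη1]; field_simp
    -- the arithmetic-geometric mean inequality
    have h1 : 10 * L * (s * x) ≤ x ^ 2 / (64 * g * (1 + L)) + 1600 * L ^ 2 * s ^ 2 * g * (1 + L) := by
      set D := 64 * g * (1 + L) with hD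
      have hD0 : 0 < D := by positivity
      have : x ^ 2 / D + 1600 * L ^ 2 * s ^ 2 * g * (1 + L) - 10 * L * (s * x) =
          (x - 5 * L * s * D) ^ 2 / D := by
        field_simp
        rw [hD]
        ring
      have h2 : 0 ≤ (x - 5 * L * s * D) ^ 2 / D := by positivity
      linarith
    have h2 : 1600 * L ^ 2 * s ^ 2 * g * (1 + L) ≤ 24000 * L ^ 4 * s ^ 2 := by
      have h3 : g * (1 + L) ≤ 5 * L * (3 * L) := by
        gcongr
        linarith
      calc 1600 * L ^ 2 * s ^ 2 * g * (1 + L) = 1600 * L ^ 2 * s ^ 2 * (g * (1 + L)) := by ring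
        _ ≤ 1600 * L ^ 2 * s ^ 2 * (5 * L * (3 * L)) := by gcongr
        _ = _ := by ring
    have h3 : 2 + g * (L + 2) + 8 * g ≤ 8000 * L ^ 4 * s ^ 2 := by
      have h4 : g * (L + 10) ≤ 5 * L * (21 * L) := by
        gcongr
        linarith
      have h5 : 1 / 4 ≤ L ^ 2 := by nlinarith
      have h6 : 113 * L ^ 2 ≤ 8000 * L ^ 4 := by nlinarith
      have h7 : 8000 * L ^ 4 ≤ 8000 * L ^ 4 * s ^ 2 :=
        le_mul_of_one_le_right (by positivity) (by rw [hs2]; exact hS1)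
      nlinarith
    rw [e2, e3]
    have h4 : A * (10 * L * (s * x)) ≤
        A * (x ^ 2 / (64 * g * (1 + L)) + 24000 * L ^ 4 * s ^ 2) := by
      gcongr
      linarith
    have h5 : A * (2 + g * (L + 2) + 8 * g) ≤ A * (8000 * L ^ 4 * s ^ 2) := by gcongr
    linarith
  · refine (regret_le_of_le hT hK hη hl σ).trans ?_
    have h1 : (T : ℝ) ≤ √((K : ℝ) * T) := by
      refine Real.le_sqrt_of_sq_le ?_
      rw [sq]
      have : (T : ℝ) ≤ K := by exact_mod_cast hKT
      gcongr
    calc (T : ℝ) ≤ √((K : ℝ) * T) := h1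
      _ ≤ S * √((K : ℝ) * T) := le_mul_of_one_le_left (by linarith) hS1
      _ ≤ _ := le_mul_of_one_le_left (by positivity) hC1

end Bounds

end SwitchOMD

end

theorem theorem2 :
    ∃ (C : ℝ) (m : ℕ), 0 < C ∧
      ∀ (T K S : ℕ), 1 ≤ K → 1 ≤ S → S ≤ T - 1 →
      ∀ (l : Fin T → Fin K → ℝ), (∀ t a, l t a ∈ Set.Icc (0 : ℝ) 1) →
        (∀ η : ℝ, η = √((SwitchOMD.numBases T : ℝ) / ((K : ℝ) * (T : ℝ))) →
          SwitchOMD.switchRegret S η l ≤ C * Real.log T ^ m *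
            min
              (SwitchOMD.expect η l fun ω =>
                √((S : ℝ) * K * T * SwitchOMD.rhoT η l (SwitchOMD.nearOpt T S) ω))
              ((S : ℝ) * √((K : ℝ) * T))) ∧
        (∀ η : ℝ, η = √((SwitchOMD.numBases T : ℝ) / (T : ℝ)) →
          SwitchOMD.switchRegret S η l ≤ C * Real.log T ^ m *
            SwitchOMD.expect η l fun ω =>
              √((S : ℝ) * K * T * SwitchOMD.rhoT η l (SwitchOMD.nearOpt T S) ω)) := by
  refine ⟨32000, 4, by norm_num, fun T K S hK hS hST l hl => ?_⟩
  have hT : 2 ≤ T := by omega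
  have hT0 : (0 : ℝ) < T := by exact_mod_cast (by omega : 0 < T)
  have hK1 : (1 : ℝ) ≤ K := by exact_mod_cast hK
  have hH := SwitchOMD.numBases_ge_one T
  have hg0 : 0 < √(SwitchOMD.numBases T : ℝ) := Real.sqrt_pos.2 (by linarith)
  have hg2 : √(SwitchOMD.numBases T : ℝ) * √(SwitchOMD.numBases T : ℝ) = SwitchOMD.numBases T :=
    Real.mul_self_sqrt (by linarith)
  have hA0 : 0 < √((K : ℝ) * T) := Real.sqrt_pos.2 (by positivity)
  have hA2 : √((K : ℝ) * T) * √((K : ℝ) * T) = K * T := Real.mul_self_sqrt (by positivity)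
  have hB0 : 0 < √(T : ℝ) := Real.sqrt_pos.2 hT0
  have hB2 : √(T : ℝ) * √(T : ℝ) = T := Real.mul_self_sqrt hT0.le
  have hBA : √(T : ℝ) ≤ √((K : ℝ) * T) := Real.sqrt_le_sqrt (by nlinarith)
  refine ⟨fun η hη => ?_, fun η hη => ?_⟩
  · rw [Real.sqrt_div (by linarith)] at hη
    have hpos : 0 < η := by rw [hη]; positivity
    have h1 : SwitchOMD.numBases T / η ≤ √(SwitchOMD.numBases T : ℝ) * √((K : ℝ) * T) := by
      rw [div_le_iff₀ hpos, hη]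
      refine le_of_eq ?_
      field_simp
      linarith
    have h2 : η * T ≤ √(SwitchOMD.numBases T : ℝ) * √((K : ℝ) * T) := by
      rw [hη, div_mul_eq_mul_div, div_le_iff₀ hA0, mul_assoc, hA2]
      gcongr
      nlinarith
    have hlog := SwitchOMD.half_le_log hT
    rw [mul_min_of_nonneg _ _ (by positivity)]
    exact le_min (SwitchOMD.switchRegret_le_expect hT hK hS hST hpos h1 h2 hl)
      (SwitchOMD.switchRegret_le_sqrt hT hK hS hST hpos hη h2 hl)
  · rw [Real.sqrt_div (by linarith)] at hη
    have hpos : 0 < η := by rw [hη]; positivity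
    refine SwitchOMD.switchRegret_le_expect hT hK hS hST hpos ?_ ?_ hl
    · rw [div_le_iff₀ hpos, hη]
      calc _ = √(SwitchOMD.numBases T : ℝ) * √(T : ℝ) *
            (√(SwitchOMD.numBases T : ℝ) / √(T : ℝ)) := by
            rw [← mul_div_assoc, eq_div_iff hB0.ne', mul_right_comm, hg2]
        _ ≤ _ := by gcongr
    · calc η * T = √(SwitchOMD.numBases T : ℝ) * √(T : ℝ) := by
            rw [hη, div_mul_eq_mul_div, div_eq_iff hB0.ne', mul_assoc, hB2]
        _ ≤ _ := by gcongr
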